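/- \textbf{Notation.} $\mathbb N=\{1,2,\dots\}$; for $M\subseteq\mathbb N$, $[M]^k$ is the set of $k$-element subsets of $M$, and $s(1)<\dots<s(k)$ are the elements of $s\in[\mathbb N]^k$; an infinite $M$ is listed as $M(1)<M(2)<\cdots$. Scalars are real. A \emph{plegma family} in $[M]^k$ is a finite sequence $(s_j)_{j=1}^m$ in $[M]^k$ with $s_1(i)<\dots<s_m(i)$ for $1\le i\le k$ and $s_m(i)<s_1(i+1)$ for $1\le i<k$. Let $X$ be a Banach space, $(x_s)_{s\in[\mathbb N]^k}$ a family in $X$, $M\subseteq\mathbb N$ infinite, and $(E,\|\cdot\|_*)$ a seminormed space with Hamel basis $(e_n)_{n\ge1}$. The $k$-subsequence $(x_s)_{s\in[M]^k}$ \emph{generates $(e_n)_n$ as a $k$-spreading model} if there is a null sequence $(\delta_n)_n$ of positive reals such that $$\Big|\,\Big\|\sum_{j=1}^m a_jx_{s_j}\Big\|-\Big\|\sum_{j=1}^m a_je_j\Big\|_*\Big|\le\delta_l$$ for all $m\le l$, all plegma families $(s_j)_{j=1}^m$ in $[M]^k$ with $s_1(1)\ge M(l)$ and all $a_1,\dots,a_m\in[-1,1]$.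 A \emph{$k$-spreading model of $X$} is a sequence $(e_n)_n$ generated in this way by some $(x_s)_{s\in[M]^k}$ in $X$. Two sequences $(y_n)_n,(z_n)_n$ in seminormed spaces are \emph{isometric} if $\|\sum_{i\le n}a_iy_i\|=\|\sum_{i\le n}a_iz_i\|$ for all $n$ and all real $a_1,\dots,a_n$, and \emph{equivalent} if there are $0<c\le C$ with $c\|\sum_{i\le n} a_iy_i\|\le\|\sum_{i\le n} a_iz_i\|\le C\|\sum_{i\le n} a_iy_i\|$ for all $n$ and all $a_1,\dots,a_n$. The $k$-subsequence $(x_s)_{s\in[M]^k}$ is \emph{$k$-Ces\`aro summable to $x_0\in X$} if $\binom nk^{-1}\sum_{s\in[\{M(1),\dots,M(n)\}]^k}x_s\to x_0$ in norm as $n\to\infty$. \textbf{The space $\mathfrak X_{k+1}$.} Let $k\ge1$. A family $\mathcal P\subseteq[\mathbb N]^{k+1}$ is \emph{Schreier plegmatic} if there are finite sets $F_1<\dots<F_{k+1}$ of positive integers (every element of $F_i$ is smaller than every element of $F_{i+1}$) with $|F_1|=\dots=|F_{k+1}|\le\min F_1$ and $\mathcal P\subseteq F_1\times\dots\times F_{k+1}$.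 Let $(e_s)_{s\in[\mathbb N]^{k+1}}$ be the unit vectors of $c_{00}([\mathbb N]^{k+1})$ and, for $x=\sum_s x(s)e_s$ in that space, put $$\|x\|=\sup\Big(\sum_{i=1}^n\Big(\sum_{s\in\mathcal P_i}|x(s)|\Big)^2\Big)^{1/2},$$ the supremum being over all finite sequences $(\mathcal P_i)_{i=1}^n$ of pairwise disjoint Schreier plegmatic families. $\mathfrak X_{k+1}$ is the completion of $(c_{00}([\mathbb N]^{k+1}),\|\cdot\|)$. \textbf{Theorem.} For every integer $k\ge1$: (1) $(e_s)_{s\in[\mathbb N]^{k+1}}$ is an unconditional basis of $\mathfrak X_{k+1}$, and $(e_s)_{s\in[\mathbb N]^{k+1}}$ itself generates a $(k+1)$-spreading model which is isometric to the usual basis of $\ell^1$; (2) $\mathfrak X_{k+1}$ is reflexive; (3) no $k$-spreading model of $\mathfrak X_{k+1}$ is equivalent to the usual basis of $\ell^1$; (4) for every infinite $M\subseteq\mathbb N$ and every $x_0\in\mathfrak X_{k+1}$, the $(k+1)$-subsequence $(e_s)_{s\in[M]^{k+1}}$ is not $(k+1)$-Ces\`aro summable to $x_0$. -/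

import Mathlib

open Filter Topology

noncomputable section

/-- `[ℕ]^k`: the `k`-element sets of positive integers, identified with their increasing
enumerations, so that `s i` is the `(i + 1)`-st smallest element of `s`.
In the same way an infinite set `M` of positive integers is identified throughout with its
increasing enumeration `M : ℕ+ ↪o ℕ+`. -/
abbrev KSub (k : ℕ) : Type := Fin k ↪o ℕ+

/-- `[A]^k` as a subset of `[ℕ]^k`. -/
def kSubsetsOf (k : ℕ) (A : Set ℕ+) : Set (KSub k) := {s | ∀ i, s i ∈ A}

theorem kSubsetsOf_finite (k : ℕ) (A : Finset ℕ+) :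
    (kSubsetsOf k (A : Set ℕ+)).Finite := by
  have h : (Set.univ.pi fun _ : Fin k => (A : Set ℕ+)).Finite :=
    Set.Finite.pi fun _ => A.finite_toSet
  refine (h.preimage (f := fun s : KSub k => (s : Fin k → ℕ+))
    (DFunLike.coe_injective.injOn)).subset ?_
  intro s hs
  simpa [Set.mem_pi, kSubsetsOf] using hs

/-- `(s_j)_{j=1}^l` is a plegma family in `[ℕ]^k`: for each `i`, `s_1(i) < … < s_l(i)`, and
all the `i`-th entries are smaller than all the later ones. -/
def IsPlegma {k l : ℕ} (s : Fin l → KSub k) : Prop :=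
  (∀ i, StrictMono fun j => s j i) ∧ ∀ i i' : Fin k, i < i' → ∀ j j', s j i < s j' i'

section SpreadingModels

variable {X : Type*} [NormedAddCommGroup X] [NormedSpace ℝ X]
variable {E : Type*} [AddCommGroup E] [Module ℝ E]
variable {F : Type*} [AddCommGroup F] [Module ℝ F]

/-- The `k`-subsequence `(x_s)_{s ∈ [M]^k}` generates the Hamel basis `(e_n)` of the seminormed
space `(E, p)` as a `k`-spreading model.  The condition `∀ j i, M n ≤ s j i` says
`s_1(1) ≥ M(n)`, since `s_1(1)` is the least of all entries of a plegma family. -/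
def GeneratesSpreadingModel (k : ℕ) (x : KSub k → X) (M : ℕ+ ↪o ℕ+)
    (p : Seminorm ℝ E) (e : Module.Basis ℕ ℝ E) : Prop :=
  ∃ δ : ℕ+ → ℝ, (∀ n, 0 < δ n) ∧ Tendsto δ atTop (𝓝 0) ∧
    ∀ (m : ℕ) (n : ℕ+), m ≤ n → ∀ s : Fin m → KSub k, IsPlegma s →
      (∀ j, s j ∈ kSubsetsOf k (Set.range M)) → (∀ j i, M n ≤ s j i) →
      ∀ a : Fin m → ℝ, (∀ j, a j ∈ Set.Icc (-1 : ℝ) 1) →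
        |‖∑ j, a j • x (s j)‖ - p (∑ j, a j • e j)| ≤ δ n

variable (X) in
/-- `(e_n)` in `(E, p)` is a `k`-spreading model of the space `X`. -/
def IsSpreadingModelOf (k : ℕ) (p : Seminorm ℝ E) (e : Module.Basis ℕ ℝ E) : Prop :=
  ∃ (x : KSub k → X) (M : ℕ+ ↪o ℕ+), GeneratesSpreadingModel k x M p e

/-- Two sequences in seminormed spaces are isometric. -/
def IsometricSeq (p : Seminorm ℝ E) (e : ℕ → E) (q : Seminorm ℝ F) (f : ℕ → F) : Prop :=
  ∀ (n : ℕ) (a : Fin n → ℝ), p (∑ i, a i • e i) = q (∑ i, a i • f i)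

/-- Two sequences in seminormed spaces are equivalent. -/
def EquivalentSeq (p : Seminorm ℝ E) (e : ℕ → E) (q : Seminorm ℝ F) (f : ℕ → F) : Prop :=
  ∃ c C : ℝ, 0 < c ∧ c ≤ C ∧ ∀ (n : ℕ) (a : Fin n → ℝ),
    c * p (∑ i, a i • e i) ≤ q (∑ i, a i • f i) ∧
    q (∑ i, a i • f i) ≤ C * p (∑ i, a i • e i)

/-- `M|n = {M(1), …, M(n)}`. -/
def initialPart (M : ℕ+ ↪o ℕ+) (n : ℕ+) : Finset ℕ+ :=
  (Finset.Icc 1 n).map M.toEmbedding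

/-- The `k`-subsequence `(x_s)_{s ∈ [M]^k}` is `k`-Cesàro summable to `x₀`. -/
def IsCesaroSummable (k : ℕ) (x : KSub k → X) (M : ℕ+ ↪o ℕ+) (x₀ : X) : Prop :=
  Tendsto (fun n : ℕ+ => ((Nat.choose n k : ℕ) : ℝ)⁻¹ •
    ∑ s ∈ (kSubsetsOf_finite k (initialPart M n)).toFinset, x s) atTop (𝓝 x₀)

end SpreadingModels

/-- The usual basis of `ℓ¹`. -/
def ellOneBasis (n : ℕ) : lp (fun _ : ℕ => ℝ) 1 := lp.single 1 n 1

/-- The norm of `ℓ¹`. -/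
def ellOneNorm : Seminorm ℝ (lp (fun _ : ℕ => ℝ) 1) := normSeminorm ℝ _

/-- Schreier plegmatic families `P ⊆ [ℕ]^{k+1}`: there are `F_1 < … < F_{k+1}` of the same
cardinality with `P ⊆ F_1 × … × F_{k+1}` and `|F_1| ≤ min F_1`. -/
def IsSchreierPlegmatic {k : ℕ} (P : Finset (KSub (k + 1))) : Prop :=
  ∃ F : Fin (k + 1) → Finset ℕ+,
    (∀ i i', i < i' → ∀ a ∈ F i, ∀ b ∈ F i', a < b) ∧
    (∀ i, (F i).card = (F 0).card) ∧
    (∀ s ∈ P, ∀ i, s i ∈ F i) ∧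
    ∀ a ∈ F 0, (F 0).card ≤ (a : ℕ)

/-- `c₀₀([ℕ]^{k+1})`, to be normed below. -/
def FrakXPre (k : ℕ) : Type := KSub (k + 1) →₀ ℝ

namespace FrakXPre

variable {k : ℕ}

instance : AddCommGroup (FrakXPre k) := inferInstanceAs (AddCommGroup (KSub (k + 1) →₀ ℝ))
instance : Module ℝ (FrakXPre k) := inferInstanceAs (Module ℝ (KSub (k + 1) →₀ ℝ))

/-- The coordinates of a finitely supported vector. -/
def coeff (x : FrakXPre k) (s : KSub (k + 1)) : ℝ := Finsupp.toFun x s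

/-- `‖P(x)‖₁ = ∑_{s ∈ P} |x(s)|`. -/
def partNorm (P : Finset (KSub (k + 1))) (x : FrakXPre k) : ℝ := ∑ s ∈ P, |x.coeff s|

/-- The values `(∑ ‖P_i(x)‖₁²)^{1/2}` over all finite sequences of pairwise disjoint Schreier
plegmatic families. -/
def normValues (x : FrakXPre k) : Set ℝ :=
  {r | ∃ (n : ℕ) (P : Fin n → Finset (KSub (k + 1))),
    (∀ i, IsSchreierPlegmatic (P i)) ∧ Pairwise (Function.onFun Disjoint P) ∧
    r = Real.sqrt (∑ i, partNorm (P i) x ^ 2)}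

instance : Norm (FrakXPre k) := ⟨fun x => sSup (normValues x)⟩

theorem norm_def (x : FrakXPre k) : ‖x‖ = sSup (normValues x) := rfl

theorem coeff_add (x y : FrakXPre k) (s) : (x + y).coeff s = x.coeff s + y.coeff s := rfl
theorem coeff_smul (c : ℝ) (x : FrakXPre k) (s) : (c • x).coeff s = c * x.coeff s := rfl

theorem partNorm_nonneg (P) (x : FrakXPre k) : 0 ≤ partNorm P x :=
  Finset.sum_nonneg fun _ _ => abs_nonneg _

theorem partNorm_add_le (P) (x y : FrakXPre k) :
    partNorm P (x + y) ≤ partNorm P x + partNorm P y := by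
  unfold partNorm
  rw [← Finset.sum_add_distrib]
  exact Finset.sum_le_sum fun s _ => by rw [coeff_add]; exact abs_add_le _ _

theorem partNorm_smul (P) (c : ℝ) (x : FrakXPre k) :
    partNorm P (c • x) = |c| * partNorm P x := by
  simp only [partNorm, coeff_smul, abs_mul, Finset.mul_sum]

theorem bddAbove_normValues (x : FrakXPre k) : BddAbove (normValues x) := by
  classical
  refine ⟨∑ s ∈ Finsupp.support x, |x.coeff s|, ?_⟩
  rintro r ⟨n, P, -, hd, rfl⟩
  have h1 : ∑ i, partNorm (P i) x ≤ ∑ s ∈ Finsupp.support x, |x.coeff s| := by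
    unfold partNorm
    rw [← Finset.sum_biUnion (fun i _ j _ hij => hd hij)]
    have h0 : ∀ s, s ∉ Finsupp.support x → |x.coeff s| = 0 := by
      intro s hs
      rw [abs_eq_zero]
      exact Finsupp.notMem_support_iff.mp hs
    rw [← Finset.sum_filter_add_sum_filter_not _ (fun s => s ∈ Finsupp.support x)]
    rw [Finset.sum_eq_zero (s := Finset.filter (fun s => s ∉ Finsupp.support x) _)
      (fun s hs => h0 s (Finset.mem_filter.mp hs).2), add_zero]
    refine Finset.sum_le_sum_of_subset_of_nonneg ?_ fun _ _ _ => abs_nonneg _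
    intro s hs
    exact (Finset.mem_filter.mp hs).2
  refine le_trans (Real.sqrt_le_iff.mpr ⟨?_, ?_⟩) h1
  · exact Finset.sum_nonneg fun i _ => partNorm_nonneg _ _
  · exact Finset.sum_sq_le_sq_sum_of_nonneg fun i _ => partNorm_nonneg _ _

theorem normValues_nonempty (x : FrakXPre k) : (normValues x).Nonempty :=
  ⟨_, 0, fun i => i.elim0, fun i => i.elim0, fun i => i.elim0, rfl⟩

theorem le_norm (x : FrakXPre k) {n : ℕ} {P : Fin n → Finset (KSub (k + 1))}
    (hP : ∀ i, IsSchreierPlegmatic (P i)) (hd : Pairwise (Function.onFun Disjoint P)) :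
    Real.sqrt (∑ i, partNorm (P i) x ^ 2) ≤ ‖x‖ :=
  le_csSup (bddAbove_normValues x) ⟨n, P, hP, hd, rfl⟩

theorem isSchreierPlegmatic_singleton (s : KSub (k + 1)) : IsSchreierPlegmatic {s} := by
  refine ⟨fun i => {s i}, ?_, ?_, ?_, ?_⟩
  · intro i i' h a ha b hb
    rw [Finset.mem_singleton] at ha hb
    subst ha hb
    exact s.strictMono h
  · intro i; simp
  · intro t ht i
    rw [Finset.mem_singleton] at ht
    simp [ht]
  · intro a _
    rw [Finset.card_singleton]
    exact a.pos

theorem abs_coeff_le_norm (x : FrakXPre k) (s : KSub (k + 1)) : |x.coeff s| ≤ ‖x‖ := by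
  have h := le_norm x (n := 1) (P := fun _ => {s}) (fun _ => isSchreierPlegmatic_singleton s)
    (fun i j hij => absurd (Subsingleton.elim i j) hij)
  simpa [partNorm, Real.sqrt_sq_eq_abs] using h

theorem sqrt_sum_add_le {n : ℕ} (f g : Fin n → ℝ) :
    Real.sqrt (∑ i, (f i + g i) ^ 2) ≤
      Real.sqrt (∑ i, f i ^ 2) + Real.sqrt (∑ i, g i ^ 2) := by
  have h := norm_add_le (WithLp.toLp 2 f : EuclideanSpace ℝ (Fin n)) (WithLp.toLp 2 g)
  simpa [EuclideanSpace.norm_eq] using h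

theorem norm_smul_le' (c : ℝ) (x : FrakXPre k) : ‖c • x‖ ≤ |c| * ‖x‖ := by
  refine csSup_le (normValues_nonempty _) ?_
  rintro r ⟨n, P, hP, hd, rfl⟩
  have h : ∑ i, partNorm (P i) (c • x) ^ 2 = |c| ^ 2 * ∑ i, partNorm (P i) x ^ 2 := by
    simp only [partNorm_smul, mul_pow, Finset.mul_sum]
  rw [h, Real.sqrt_mul (sq_nonneg _), Real.sqrt_sq (abs_nonneg c)]
  exact mul_le_mul_of_nonneg_left (le_norm x hP hd) (abs_nonneg c)

theorem normCore (k : ℕ) : NormedSpace.Core ℝ (FrakXPre k) where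
  norm_nonneg x := (Real.sqrt_nonneg _).trans
    (le_norm x (n := 0) (P := fun i => i.elim0) (fun i => i.elim0) (fun i => i.elim0))
  norm_smul c x := by
    rw [Real.norm_eq_abs]
    refine le_antisymm (norm_smul_le' c x) ?_
    rcases eq_or_ne c 0 with rfl | hc
    · rw [abs_zero, zero_mul]
      exact (Real.sqrt_nonneg _).trans
        (le_norm _ (n := 0) (P := fun i => i.elim0) (fun i => i.elim0) (fun i => i.elim0))
    · have h := norm_smul_le' c⁻¹ (c • x)
      rw [smul_smul, inv_mul_cancel₀ hc, one_smul, abs_inv] at h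
      have hc' : 0 < |c| := abs_pos.mpr hc
      calc |c| * ‖x‖ ≤ |c| * (|c|⁻¹ * ‖c • x‖) := mul_le_mul_of_nonneg_left h hc'.le
        _ = ‖c • x‖ := by rw [← mul_assoc, mul_inv_cancel₀ hc'.ne', one_mul]
  norm_triangle x y := by
    refine csSup_le (normValues_nonempty _) ?_
    rintro r ⟨n, P, hP, hd, rfl⟩
    refine le_trans (Real.sqrt_le_sqrt (Finset.sum_le_sum fun i _ => ?_))
      ((sqrt_sum_add_le (fun i => partNorm (P i) x) fun i => partNorm (P i) y).trans
        (add_le_add (le_norm x hP hd) (le_norm y hP hd)))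
    exact pow_le_pow_left₀ (partNorm_nonneg _ _) (partNorm_add_le _ _ _) 2
  norm_eq_zero_iff x := by
    constructor
    · intro h
      refine Finsupp.ext fun s => ?_
      have hs := abs_coeff_le_norm x s
      rw [h] at hs
      exact abs_nonpos_iff.mp hs
    · rintro rfl
      have h := norm_smul_le' 0 (0 : FrakXPre k)
      rw [smul_zero, abs_zero, zero_mul] at h
      exact le_antisymm h ((Real.sqrt_nonneg _).trans
        (le_norm _ (n := 0) (P := fun i => i.elim0) (fun i => i.elim0) (fun i => i.elim0)))

instance : NormedAddCommGroup (FrakXPre k) := NormedAddCommGroup.ofCore (normCore k)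
instance : NormedSpace ℝ (FrakXPre k) := NormedSpace.ofCore (normCore k)

end FrakXPre

/-- The unit vectors `e_s` of `c₀₀([ℕ]^{k+1})`. -/
def FrakXPre.unit (k : ℕ) (s : KSub (k + 1)) : FrakXPre k :=
  (Finsupp.single s 1 : KSub (k + 1) →₀ ℝ)

/-- The space `𝔛_{k+1}`, the completion of `c₀₀([ℕ]^{k+1})` under the norm above. -/
abbrev FrakX (k : ℕ) : Type := UniformSpace.Completion (FrakXPre k)

/-- The unit vectors `e_s` of `c₀₀([ℕ]^{k+1})`, as elements of `𝔛_{k+1}`. -/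
def frakXBasis (k : ℕ) (s : KSub (k + 1)) : FrakX k :=
  (FrakXPre.unit k s : UniformSpace.Completion (FrakXPre k))

end

/-! The norm is an `ℓ²`-sum of `ℓ¹`-norms over disjoint Schreier plegmatic families. A plegma family
of length `m` with entries at least `m` is itself Schreier plegmatic, so the unit vectors generate
`ℓ¹` isometrically. Likewise, a fixed proportion of the `(k+1)`-subsets of an initial part of `M`
lies in one such family, so Cesàro averages stay large in norm although each of their coordinates
tends to zero.

Two facts drive the rest. Witnessing families for disjoint sets of coordinates can be concatenated,
which gives a lower 2-estimate (`norm_sq_restrict_add_le`). Vectors of which every Schreier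
plegmatic family meets at most `m` satisfy an upper 2-estimate (`norm_sq_sum_le_of_card_meet_le`).

For `m ≤ k`, a bounded family `x_s` indexed by `m`-sets is cut according to whether the first entry
of a coordinate `σ` exceeds some `r`. Above `r`, Ramsey's theorem and the lower 2-estimate make
`x_s` small on those `σ` having an entry in a gap of `s`. The remaining `σ` have their `k + 1`
entries in `m` short intervals around the entries of `s`, so two entries share an interval. A
Schreier plegmatic family can meet only `k + 1` of the resulting sets along a plegma family, and
averages of length `N` are of order `N^(-1/2)` (`exists_norm_sum_tail_le`). Up to `r`, Schreier
plegmatic families have boundedly many elements, so the norm is equivalent to that of `ℓ²`. Ramsey's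
theorem makes the inner products over plegma pairs nearly constant, and averages with alternating
signs cancel the constant (`norm_sq_sum_le_of_ip_near`). This excludes `ℓ¹` as a `k`-spreading
model.

The same splitting with `m = 1` shows that disjointly supported bounded sequences have averages
tending to zero. Hence the basis is shrinking; the lower 2-estimate makes it boundedly complete, and
reflexivity follows as in James' theorem. -/

/-! ### Ramsey's theorem -/

theorem Ultrafilter.exists_eventually_eq_of_finite {α κ : Type*} [Finite κ] (U : Ultrafilter α)
    (h : α → κ) : ∃ c, ∀ᶠ a in (U : Filter α), h a = c := by
  obtain ⟨c, hc⟩ := Ultrafilter.eq_pure_of_finite (U.map h)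
  refine ⟨c, ?_⟩
  have : {c} ∈ U.map h := by rw [hc]; exact rfl
  exact this

/-- The infinite Ramsey theorem. -/
theorem exists_homogeneous {κ : Type*} [Finite κ] (n : ℕ) (f : KSub n → κ) :
    ∃ (L : ℕ+ ↪o ℕ+) (c : κ), ∀ s : KSub n, f (s.trans L) = c := by
  classical
  have hne : Nonempty κ := ⟨f (OrderEmbedding.ofStrictMono (fun i : Fin n => (i : ℕ).succPNat)
    fun i j hij => Nat.succPNat_lt_succPNat.2 hij)⟩
  let U : Ultrafilter ℕ+ := hyperfilter ℕ+
  choose lim hlim using fun h : ℕ+ → κ => U.exists_eventually_eq_of_finite h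
  let g : Finset ℕ+ → κ := fun t =>
    if h : t.card = n then f (t.orderEmbOfFin h) else Classical.choice hne
  -- `G r t` is the colour left after adjoining `r` further elements to `t`, each taken to its limit
  -- along the ultrafilter. The default colour in `g` is irrelevant to the conclusion.
  let G : ℕ → Finset ℕ+ → κ := fun r => r.rec g fun _ G' t => lim fun a => G' (insert a t)
  have hG : ∀ r t, ∀ᶠ a in (U : Filter ℕ+), G r (insert a t) = G (r + 1) t :=
    fun r t => hlim fun a => G r (insert a t)
  have hstep : ∀ A : Finset ℕ+, ∃ a, (∀ b ∈ A, b < a) ∧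
      ∀ t ∈ A.powerset, ∀ r ∈ Finset.range n, G r (insert a t) = G (r + 1) t := by
    intro A
    have h1 : ∀ᶠ a in (U : Filter ℕ+), ∀ b ∈ A, b < a := by
      rw [Filter.eventually_all_finset]
      intro b _
      refine hyperfilter_le_cofinite ?_
      rw [mem_cofinite]
      exact (Set.finite_Iic b).subset fun a (ha : ¬ b < a) => not_lt.1 ha
    have h2 : ∀ᶠ a in (U : Filter ℕ+), ∀ t ∈ A.powerset, ∀ r ∈ Finset.range n,
        G r (insert a t) = G (r + 1) t := by
      rw [Filter.eventually_all_finset]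
      intro t _
      rw [Filter.eventually_all_finset]
      exact fun r _ => hG r t
    exact (h1.and h2).exists
  choose a ha1 ha2 using hstep
  let A : ℕ → Finset ℕ+ := fun i => i.rec ∅ fun _ B => insert (a B) B
  have hA : ∀ i, A (i + 1) = insert (a (A i)) (A i) := fun _ => rfl
  have hAmono : Monotone A := monotone_nat_of_le_succ fun i => by
    rw [hA]; exact Finset.subset_insert _ _
  have hmem : ∀ i, a (A i) ∈ A (i + 1) := fun i => by rw [hA]; exact Finset.mem_insert_self _ _
  have hseq : StrictMono fun i => a (A i) := strictMono_nat_of_lt_succ fun i => ha1 _ _ (hmem i)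
  -- Each new point was chosen to realise the limit colour for all sets of earlier points. Peeling
  -- off the largest point trades one element of `t` for one more limit.
  have hhom : ∀ N t, t ⊆ A N → ∀ r, r + t.card ≤ n → G r t = G (r + t.card) ∅ := by
    intro N
    induction N with
    | zero =>
      intro t ht r _
      have : t = ∅ := Finset.subset_empty.1 ht
      subst this; rfl
    | succ N ih =>
      intro t ht r hr
      rw [hA] at ht
      by_cases hat : a (A N) ∈ t
      · have hsub : t.erase (a (A N)) ⊆ A N := Finset.subset_insert_iff.1 ht
        have hc := Finset.card_erase_add_one hat
        have h1 := ha2 (A N) _ (Finset.mem_powerset.2 hsub) r (Finset.mem_range.2 (by omega))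
        rw [Finset.insert_erase hat] at h1
        rw [h1, ih _ hsub (r + 1) (by omega)]
        congr 1; omega
      · exact ih t ((Finset.subset_insert_iff_of_notMem hat).1 ht) r hr
  let L : ℕ+ ↪o ℕ+ := OrderEmbedding.ofStrictMono (fun i : ℕ+ => a (A i.natPred)) fun i j hij =>
    hseq (PNat.natPred_lt_natPred.2 hij)
  refine ⟨L, G n ∅, fun s => ?_⟩
  let t : Finset ℕ+ := Finset.univ.map (s.trans L).toEmbedding
  have htc : t.card = n := by simp [t]
  have h0 : G 0 t = f (s.trans L) := by
    have : s.trans L = t.orderEmbOfFin htc :=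
      DFunLike.coe_injective (Finset.orderEmbOfFin_unique htc (fun i => by simp [t])
        (OrderEmbedding.strictMono (s.trans L)))
    change (if h : t.card = n then f (t.orderEmbOfFin h) else _) = _
    rw [dif_pos htc, this]
  obtain ⟨N, hN⟩ : ∃ N, t ⊆ A N := by
    refine ⟨Finset.univ.sup fun i => (s i).natPred + 1, fun b hb => ?_⟩
    simp only [t, Finset.mem_map, Finset.mem_univ, true_and] at hb
    obtain ⟨i, rfl⟩ := hb
    exact hAmono (Finset.le_sup (f := fun i => (s i).natPred + 1) (Finset.mem_univ i)) (hmem _)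
  rw [← h0, hhom N t hN 0 (by omega), htc, zero_add]

/-- The bounded range splits into finitely many cells of width `η`, which serve as colours. -/
theorem exists_homogeneous_approx {n : ℕ} (f : KSub n → ℝ) {C η : ℝ} (hη : 0 < η)
    (hf : ∀ s, |f s| ≤ C) :
    ∃ (L : ℕ+ ↪o ℕ+) (c : ℝ), ∀ s : KSub n, |f (s.trans L) - c| ≤ η := by
  have hmem : ∀ s, ⌊f s / η⌋ ∈ Set.Icc ⌊-C / η⌋ ⌊C / η⌋ := fun s =>
    ⟨Int.floor_le_floor (div_le_div_of_nonneg_right (neg_le_of_abs_le (hf s)) hη.le),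
      Int.floor_le_floor (div_le_div_of_nonneg_right (le_of_abs_le (hf s)) hη.le)⟩
  obtain ⟨L, c, hL⟩ := exists_homogeneous n fun s => (⟨_, hmem s⟩ : Set.Icc ⌊-C / η⌋ ⌊C / η⌋)
  refine ⟨L, c * η, fun s => ?_⟩
  have h : ⌊f (s.trans L) / η⌋ = c := congrArg Subtype.val (hL s)
  have h1 := Int.floor_le (f (s.trans L) / η)
  have h2 := Int.lt_floor_add_one (f (s.trans L) / η)
  rw [h] at h1 h2
  rw [le_div_iff₀ hη] at h1
  rw [div_lt_iff₀ hη] at h2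
  rw [abs_le]
  constructor <;> linarith

/-! ### Schreier plegmatic families -/

theorem IsSchreierPlegmatic.mono {k : ℕ} {P Q : Finset (KSub (k + 1))}
    (hP : IsSchreierPlegmatic P) (h : Q ⊆ P) : IsSchreierPlegmatic Q := by
  obtain ⟨F, h1, h2, h3, h4⟩ := hP
  exact ⟨F, h1, h2, fun s hs => h3 s (h hs), h4⟩

/-- A Schreier plegmatic family contained in `F_1 × … × F_{k+1}` with `a ∈ F_1` has at most
`a ^ (k + 1)` elements. -/
theorem IsSchreierPlegmatic.card_le {k : ℕ} {P : Finset (KSub (k + 1))}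
    (hP : IsSchreierPlegmatic P) {s : KSub (k + 1)} (hs : s ∈ P) :
    P.card ≤ (s 0 : ℕ) ^ (k + 1) := by
  obtain ⟨F, -, h2, h3, h4⟩ := hP
  have hc : P.card ≤ (Fintype.piFinset F).card :=
    Finset.card_le_card_of_injOn (fun t i => t i)
      (fun t ht => Fintype.mem_piFinset.2 fun i => h3 t ht i) DFunLike.coe_injective.injOn
  rw [Fintype.card_piFinset, Finset.prod_congr rfl fun i _ => h2 i, Finset.prod_const,
    Finset.card_univ, Fintype.card_fin] at hc
  exact hc.trans (Nat.pow_le_pow_left (h4 _ (h3 s hs 0)) _)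

/-- If `σ` and `τ` lie in one Schreier plegmatic family, the `q`-th entry of the one is below every
later entry of the other. -/
theorem IsSchreierPlegmatic.lt {k : ℕ} {P : Finset (KSub (k + 1))}
    (hP : IsSchreierPlegmatic P) {σ τ : KSub (k + 1)} (hσ : σ ∈ P) (hτ : τ ∈ P)
    {i j : Fin (k + 1)} (hij : i < j) : σ i < τ j := by
  obtain ⟨F, h1, -, h3, -⟩ := hP
  exact h1 i j hij _ (h3 σ hσ i) _ (h3 τ hτ j)

/-! ### Restrictions, 2-estimates and comparison with `ℓ²` -/

namespace FrakXPre

variable {k : ℕ}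

theorem ext_coeff {x y : FrakXPre k} (h : ∀ s, x.coeff s = y.coeff s) : x = y := Finsupp.ext h

/-- The coordinate functionals on `c₀₀`. -/
def coeffₗ (s : KSub (k + 1)) : FrakXPre k →ₗ[ℝ] ℝ where
  toFun x := x.coeff s
  map_add' x y := coeff_add x y s
  map_smul' c x := coeff_smul c x s

theorem coeff_sum {ι : Type*} (T : Finset ι) (x : ι → FrakXPre k) (s : KSub (k + 1)) :
    (∑ i ∈ T, x i).coeff s = ∑ i ∈ T, (x i).coeff s := map_sum (coeffₗ s) x T

open Classical in
/-- The restriction of a vector to a set of coordinates. -/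
noncomputable def restrict (A : Set (KSub (k + 1))) : FrakXPre k →ₗ[ℝ] FrakXPre k where
  toFun x := Finsupp.filter (· ∈ A) (x : KSub (k + 1) →₀ ℝ)
  map_add' _ _ := Finsupp.filter_add
  map_smul' _ _ := Finsupp.filter_smul

theorem coeff_restrict (A : Set (KSub (k + 1))) (x : FrakXPre k) (s : KSub (k + 1)) :
    (restrict A x).coeff s = A.indicator x.coeff s := by
  classical
  exact Finsupp.filter_apply (· ∈ A) (x : KSub (k + 1) →₀ ℝ) s

theorem restrict_restrict (A B : Set (KSub (k + 1))) (x : FrakXPre k) :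
    restrict A (restrict B x) = restrict (A ∩ B) x := by
  refine ext_coeff fun s => ?_
  have : (restrict B x).coeff = B.indicator x.coeff := funext (coeff_restrict B x)
  rw [coeff_restrict, coeff_restrict, this, Set.indicator_indicator]

theorem restrict_add_of_disjoint {A B : Set (KSub (k + 1))} (h : Disjoint A B) (x : FrakXPre k) :
    restrict A x + restrict B x = restrict (A ∪ B) x := by
  refine ext_coeff fun s => ?_
  rw [coeff_add, coeff_restrict, coeff_restrict, coeff_restrict, Set.indicator_union_of_disjoint h]

theorem restrict_eq_self {A : Set (KSub (k + 1))} {x : FrakXPre k}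
    (h : ∀ s, x.coeff s ≠ 0 → s ∈ A) : restrict A x = x := by
  refine ext_coeff fun s => ?_
  rw [coeff_restrict]
  by_cases hs : s ∈ A
  · rw [Set.indicator_of_mem hs]
  · rw [Set.indicator_of_notMem hs]
    by_contra h0
    exact hs (h s (Ne.symm h0))

theorem restrict_add_compl (A : Set (KSub (k + 1))) (x : FrakXPre k) :
    restrict A x + restrict Aᶜ x = x := by
  rw [restrict_add_of_disjoint disjoint_compl_right, Set.union_compl_self]
  exact restrict_eq_self fun s _ => Set.mem_univ s

theorem finite_support (x : FrakXPre k) : {s | x.coeff s ≠ 0}.Finite :=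
  (Finsupp.hasFiniteSupport (x : KSub (k + 1) →₀ ℝ))

theorem sum_partNorm_sq_le {ι : Type*} [Fintype ι] {P : ι → Finset (KSub (k + 1))}
    (x : FrakXPre k) (hP : ∀ i, IsSchreierPlegmatic (P i))
    (hd : Pairwise (Function.onFun Disjoint P)) : ∑ i, partNorm (P i) x ^ 2 ≤ ‖x‖ ^ 2 := by
  let e := (Fintype.equivFin ι).symm
  have h := le_norm x (P := fun i => P (e i)) (fun i => hP _)
    (fun i j hij => hd (e.injective.ne hij))
  rw [← e.sum_comp]
  exact (Real.sqrt_le_left (norm_nonneg x)).1 h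

theorem norm_sq_le {x : FrakXPre k} {c : ℝ}
    (h : ∀ (n : ℕ) (P : Fin n → Finset (KSub (k + 1))), (∀ i, IsSchreierPlegmatic (P i)) →
      Pairwise (Function.onFun Disjoint P) → ∑ i, partNorm (P i) x ^ 2 ≤ c) : ‖x‖ ^ 2 ≤ c := by
  have hc : 0 ≤ c := by
    simpa using h 0 (fun i => i.elim0) (fun i => i.elim0) (fun i => i.elim0)
  refine (Real.le_sqrt (norm_nonneg x) hc).1 ?_
  refine csSup_le (normValues_nonempty x) ?_
  rintro r ⟨n, P, hP, hd, rfl⟩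
  exact Real.sqrt_le_sqrt (h n P hP hd)

theorem norm_mono {x y : FrakXPre k} (h : ∀ s, |x.coeff s| ≤ |y.coeff s|) : ‖x‖ ≤ ‖y‖ := by
  refine le_of_sq_le_sq (norm_sq_le fun n P hP hd => ?_) (norm_nonneg y)
  refine (Finset.sum_le_sum fun i _ => ?_).trans (sum_partNorm_sq_le y hP hd)
  exact pow_le_pow_left₀ (partNorm_nonneg _ _) (Finset.sum_le_sum fun s _ => h s) 2

theorem norm_restrict_le (A : Set (KSub (k + 1))) (x : FrakXPre k) : ‖restrict A x‖ ≤ ‖x‖ := by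
  refine norm_mono fun s => ?_
  rw [coeff_restrict]
  by_cases hs : s ∈ A
  · rw [Set.indicator_of_mem hs]
  · rw [Set.indicator_of_notMem hs, abs_zero]; exact abs_nonneg _

theorem norm_restrict_mono {A B : Set (KSub (k + 1))} (h : A ⊆ B) (x : FrakXPre k) :
    ‖restrict A x‖ ≤ ‖restrict B x‖ := by
  rw [← Set.inter_eq_left.2 h, ← restrict_restrict]
  exact norm_restrict_le _ _

theorem norm_restrict_union_le (A B : Set (KSub (k + 1))) (x : FrakXPre k) :
    ‖restrict (A ∪ B) x‖ ≤ ‖restrict A x‖ + ‖restrict B x‖ := by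
  rw [← Set.union_sdiff_self, ← restrict_add_of_disjoint Set.disjoint_sdiff_right]
  exact (norm_add_le _ _).trans (add_le_add le_rfl (norm_restrict_mono Set.sdiff_subset x))

theorem norm_restrict_biUnion_le {ι : Type*} (T : Finset ι) (A : ι → Set (KSub (k + 1)))
    (x : FrakXPre k) : ‖restrict (⋃ i ∈ T, A i) x‖ ≤ ∑ i ∈ T, ‖restrict (A i) x‖ := by
  classical
  induction T using Finset.induction_on with
  | empty =>
    have : restrict (∅ : Set (KSub (k + 1))) x = 0 := ext_coeff fun s => by
      rw [coeff_restrict, Set.indicator_empty]; rfl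
    simp [this]
  | insert i T hi ih =>
    rw [Finset.set_biUnion_insert, Finset.sum_insert hi]
    exact (norm_restrict_union_le _ _ x).trans (add_le_add le_rfl ih)

theorem partNorm_restrict (P : Finset (KSub (k + 1))) (A : Set (KSub (k + 1)))
    [DecidablePred (· ∈ A)] (x : FrakXPre k) :
    partNorm P (restrict A x) = partNorm (P.filter (· ∈ A)) x := by
  unfold partNorm
  rw [Finset.sum_filter]
  refine Finset.sum_congr rfl fun s _ => ?_
  rw [coeff_restrict]
  by_cases hs : s ∈ A <;> simp [hs]

/-- Near-optimal families for the two parts, cut down to `A` and to `B`, are pairwise disjoint and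
together form an admissible sequence for `x`. The two suprema are taken one after the other. -/
theorem norm_sq_restrict_add_le {A B : Set (KSub (k + 1))} (h : Disjoint A B) (x : FrakXPre k) :
    ‖restrict A x‖ ^ 2 + ‖restrict B x‖ ^ 2 ≤ ‖x‖ ^ 2 := by
  classical
  rw [← le_sub_iff_add_le]
  refine norm_sq_le fun n P hP hPd => ?_
  rw [le_sub_comm]
  refine norm_sq_le fun m Q hQ hQd => ?_
  rw [le_sub_iff_add_le]
  simp only [partNorm_restrict]
  let R : Fin m ⊕ Fin n → Finset (KSub (k + 1)) :=
    Sum.elim (fun i => (Q i).filter (· ∈ B)) fun i => (P i).filter (· ∈ A)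
  have hR := sum_partNorm_sq_le (P := R) x
    (by
      rintro (i | i)
      · exact (hQ i).mono (Finset.filter_subset _ _)
      · exact (hP i).mono (Finset.filter_subset _ _))
    (by
      rintro (i | i) (j | j) hij
      · exact (hQd fun e => hij (congrArg _ e)).mono (Finset.filter_subset _ _)
          (Finset.filter_subset _ _)
      · refine Finset.disjoint_left.2 fun s hs hs' => ?_
        exact Set.disjoint_left.1 h (Finset.mem_filter.1 hs').2 (Finset.mem_filter.1 hs).2
      · refine Finset.disjoint_left.2 fun s hs hs' => ?_
        exact Set.disjoint_left.1 h (Finset.mem_filter.1 hs).2 (Finset.mem_filter.1 hs').2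
      · exact (hPd fun e => hij (congrArg _ e)).mono (Finset.filter_subset _ _)
          (Finset.filter_subset _ _))
  rw [Fintype.sum_sum_type] at hR
  exact hR

theorem sum_norm_sq_restrict_le {ι : Type*} (T : Finset ι) {A : ι → Set (KSub (k + 1))}
    (hA : Pairwise (Function.onFun Disjoint A)) (x : FrakXPre k) :
    ∑ i ∈ T, ‖restrict (A i) x‖ ^ 2 ≤ ‖x‖ ^ 2 := by
  classical
  suffices h : ∑ i ∈ T, ‖restrict (A i) x‖ ^ 2 ≤ ‖restrict (⋃ i ∈ T, A i) x‖ ^ 2 from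
    h.trans (pow_le_pow_left₀ (norm_nonneg _) (norm_restrict_le _ _) 2)
  induction T using Finset.induction_on with
  | empty => simp
  | insert i T hi ih =>
    rw [Finset.sum_insert hi]
    refine (add_le_add le_rfl ih).trans ?_
    have hd : Disjoint (A i) (⋃ j ∈ T, A j) := by
      rw [Set.disjoint_iUnion₂_right]
      exact fun j hj => hA fun e => hi (e ▸ hj)
    have := norm_sq_restrict_add_le hd (restrict (⋃ j ∈ insert i T, A j) x)
    rw [Finset.set_biUnion_insert] at this ⊢
    rwa [restrict_restrict, restrict_restrict,
      Set.inter_eq_left.2 Set.subset_union_left, Set.inter_eq_left.2 Set.subset_union_right] at this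

/-- If every Schreier plegmatic family meets the supports of at most `m` of the vectors `w j`, these
vectors satisfy an upper 2-estimate. -/
theorem norm_sq_sum_le_of_card_meet_le {N m : ℕ} (w : Fin N → FrakXPre k) {C : ℝ}
    (hw : ∀ j, ‖w j‖ ≤ C)
    (hm : ∀ P : Finset (KSub (k + 1)), IsSchreierPlegmatic P →
      ∀ J : Finset (Fin N), (∀ j ∈ J, ∃ s ∈ P, (w j).coeff s ≠ 0) → J.card ≤ m)
    (a : Fin N → ℝ) : ‖∑ j, a j • w j‖ ^ 2 ≤ m * C ^ 2 * ∑ j, a j ^ 2 := by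
  classical
  refine norm_sq_le fun n P hP hd => ?_
  have h1 : ∀ i, partNorm (P i) (∑ j, a j • w j) ^ 2 ≤
      m * ∑ j, a j ^ 2 * partNorm (P i) (w j) ^ 2 := by
    intro i
    -- Only the vectors seen by `P i` contribute; there are at most `m` of them, so Cauchy–Schwarz
    -- costs a factor `m`.
    let J : Finset (Fin N) := Finset.univ.filter fun j => ∃ s ∈ P i, (w j).coeff s ≠ 0
    have hJ : J.card ≤ m := hm _ (hP i) J fun j hj => (Finset.mem_filter.1 hj).2
    have h0 : ∀ j ∉ J, partNorm (P i) (w j) = 0 := by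
      intro j hj
      refine Finset.sum_eq_zero fun s hs => ?_
      by_contra hne
      exact hj (Finset.mem_filter.2 ⟨Finset.mem_univ _, s, hs, fun h => hne (by rw [h, abs_zero])⟩)
    have h2 : partNorm (P i) (∑ j, a j • w j) ≤ ∑ j ∈ J, |a j| * partNorm (P i) (w j) := by
      have : ∀ T : Finset (Fin N), partNorm (P i) (∑ j ∈ T, a j • w j) ≤
          ∑ j ∈ T, |a j| * partNorm (P i) (w j) := by
        intro T
        simp only [partNorm, Finset.mul_sum]
        rw [Finset.sum_comm]
        refine Finset.sum_le_sum fun s _ => ?_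
        rw [coeff_sum]
        refine (Finset.abs_sum_le_sum_abs _ _).trans (Finset.sum_le_sum fun j _ => ?_)
        rw [coeff_smul, abs_mul]
      refine (this Finset.univ).trans (Finset.sum_subset (Finset.subset_univ J) ?_).ge
      intro j _ hj
      rw [h0 j hj, mul_zero]
    calc partNorm (P i) (∑ j, a j • w j) ^ 2
        ≤ (∑ j ∈ J, |a j| * partNorm (P i) (w j)) ^ 2 :=
          pow_le_pow_left₀ (partNorm_nonneg _ _) h2 2
      _ ≤ J.card * ∑ j ∈ J, (|a j| * partNorm (P i) (w j)) ^ 2 := sq_sum_le_card_mul_sum_sq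
      _ ≤ m * ∑ j, a j ^ 2 * partNorm (P i) (w j) ^ 2 := by
          simp only [mul_pow, sq_abs]
          refine mul_le_mul (by exact_mod_cast hJ) ?_ ?_ (Nat.cast_nonneg _)
          · exact Finset.sum_le_sum_of_subset_of_nonneg (Finset.subset_univ _)
              fun _ _ _ => by positivity
          · exact Finset.sum_nonneg fun _ _ => by positivity
  refine (Finset.sum_le_sum fun i _ => h1 i).trans ?_
  rw [← Finset.mul_sum, Finset.sum_comm, mul_assoc]
  refine mul_le_mul_of_nonneg_left ?_ (Nat.cast_nonneg _)
  rw [Finset.mul_sum]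
  refine Finset.sum_le_sum fun j _ => ?_
  rw [← Finset.mul_sum, mul_comm]
  refine mul_le_mul_of_nonneg_right ?_ (sq_nonneg _)
  exact (sum_partNorm_sq_le (w j) hP hd).trans (pow_le_pow_left₀ (norm_nonneg _) (hw j) 2)

/-- The inner product of `ℓ²` on `c₀₀`. -/
noncomputable def ip : FrakXPre k →ₗ[ℝ] FrakXPre k →ₗ[ℝ] ℝ :=
  Finsupp.linearCombination ℝ (coeffₗ (k := k))

theorem ip_eq_sum (x y : FrakXPre k) {T : Finset (KSub (k + 1))}
    (hT : ∀ s, x.coeff s ≠ 0 → s ∈ T) : ip x y = ∑ s ∈ T, x.coeff s * y.coeff s := by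
  have h : ip x = ∑ s ∈ T, x.coeff s • coeffₗ s :=
    Finsupp.sum_of_support_subset _ (fun s hs => hT s (Finsupp.mem_support_iff.1 hs)) _
      fun s _ => zero_smul _ _
  rw [h]
  simp [LinearMap.sum_apply, coeffₗ]

theorem ip_comm (x y : FrakXPre k) : ip x y = ip y x := by
  classical
  rw [ip_eq_sum x y (T := x.finite_support.toFinset ∪ y.finite_support.toFinset)
    (fun s hs => by simp [hs]), ip_eq_sum y x
    (T := x.finite_support.toFinset ∪ y.finite_support.toFinset) (fun s hs => by simp [hs])]
  exact Finset.sum_congr rfl fun s _ => mul_comm _ _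

theorem ip_self_nonneg (x : FrakXPre k) : 0 ≤ ip x x := by
  rw [ip_eq_sum x x (T := x.finite_support.toFinset) (fun s hs => by simp [hs])]
  exact Finset.sum_nonneg fun s _ => mul_self_nonneg _

theorem ip_self_le (x : FrakXPre k) : ip x x ≤ ‖x‖ ^ 2 := by
  rw [ip_eq_sum x x (T := x.finite_support.toFinset) (fun s hs => by simp [hs]),
    ← Finset.sum_coe_sort]
  refine le_trans (Finset.sum_le_sum fun s _ => ?_) (sum_partNorm_sq_le x
    (P := fun s : x.finite_support.toFinset => {s.1}) (fun s => isSchreierPlegmatic_singleton _)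
    fun s t hst => ?_)
  · simp [partNorm, sq]
  · exact Finset.disjoint_singleton.2 fun e => hst (Subtype.ext e)

/-- Positivity of the form at `x + y` and `x - y` bounds `2 |ip x y|` by `ip x x + ip y y`. -/
theorem abs_ip_le {x y : FrakXPre k} {C : ℝ} (hx : ‖x‖ ≤ C) (hy : ‖y‖ ≤ C) :
    |ip x y| ≤ C ^ 2 := by
  have h1 := ip_self_nonneg (x + y)
  have h2 := ip_self_nonneg (x - y)
  simp only [map_add, map_sub, LinearMap.add_apply, LinearMap.sub_apply, ip_comm y x] at h1 h2
  have h3 := (ip_self_le x).trans (pow_le_pow_left₀ (norm_nonneg _) hx 2)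
  have h4 := (ip_self_le y).trans (pow_le_pow_left₀ (norm_nonneg _) hy 2)
  rw [abs_le]
  constructor <;> linarith

/-- A Schreier plegmatic family with a member whose first entry is at most `r` has at most `r ^ (k +
1)` elements, so Cauchy–Schwarz turns its `ℓ¹`-norm into an `ℓ²`-norm. With `ip_self_le`, the norm
is Hilbertian on such coordinates. -/
theorem norm_sq_le_ip {x : FrakXPre k} {r : ℕ}
    (hx : ∀ s, x.coeff s ≠ 0 → (s 0 : ℕ) ≤ r) : ‖x‖ ^ 2 ≤ r ^ (k + 1) * ip x x := by
  classical
  refine norm_sq_le fun n P hP hd => ?_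
  have h1 : ∀ i, partNorm (P i) x ^ 2 ≤ r ^ (k + 1) * ∑ s ∈ P i, x.coeff s * x.coeff s := by
    intro i
    let Q := (P i).filter fun s => x.coeff s ≠ 0
    have hQ : partNorm (P i) x = ∑ s ∈ Q, |x.coeff s| := by
      refine (Finset.sum_subset (Finset.filter_subset _ _) fun s hs hs' => ?_).symm
      by_contra h
      exact hs' (Finset.mem_filter.2 ⟨hs, fun e => h (by rw [e, abs_zero])⟩)
    have hc : Q.card ≤ r ^ (k + 1) := by
      rcases Q.eq_empty_or_nonempty with h | ⟨s, hs⟩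
      · rw [h]; exact Nat.zero_le _
      · exact (((hP i).mono (Finset.filter_subset _ _)).card_le hs).trans
          (Nat.pow_le_pow_left (hx s (Finset.mem_filter.1 hs).2) _)
    rw [hQ]
    refine (sq_sum_le_card_mul_sum_sq (s := Q) (f := fun s => |x.coeff s|)).trans
      (mul_le_mul (by exact_mod_cast hc) ?_ ?_ (by positivity))
    · simp only [sq_abs]
      simp only [sq]
      exact Finset.sum_le_sum_of_subset_of_nonneg (Finset.filter_subset _ _)
        fun _ _ _ => mul_self_nonneg _
    · exact Finset.sum_nonneg fun _ _ => sq_nonneg _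
  refine (Finset.sum_le_sum fun i _ => h1 i).trans ?_
  rw [← Finset.mul_sum]
  refine mul_le_mul_of_nonneg_left ?_ (by positivity)
  rw [← Finset.sum_biUnion (fun i _ j _ hij => hd hij),
    ip_eq_sum x x (T := x.finite_support.toFinset ∪ Finset.univ.biUnion P)
      (fun s hs => by simp [hs])]
  exact Finset.sum_le_sum_of_subset_of_nonneg Finset.subset_union_right
    fun _ _ _ => mul_self_nonneg _

end FrakXPre

/-! ### Smallness on gaps -/

/-- The order embedding `Fin m ↪o Fin (m + 2)` which omits `p` and `p + 1`. -/
def skipPair (m p : ℕ) : Fin m ↪o Fin (m + 2) :=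
  OrderEmbedding.ofStrictMono
    (fun i => if (i : ℕ) < p then ⟨i, by omega⟩ else ⟨i + 2, by omega⟩) fun i j hij => by
      have : (i : ℕ) < j := hij
      rw [Fin.lt_def]
      beta_reduce
      split_ifs <;> simp only <;> omega

theorem skipPair_apply {m p : ℕ} (i : Fin m) :
    skipPair m p i = if (i : ℕ) < p then ⟨i, by omega⟩ else ⟨i + 2, by omega⟩ := rfl

/-- Encodes a set together with an interval inside one of its gaps as a single set with two more
elements, to which Ramsey's theorem applies. -/
theorem exists_skipPair_eq {m p : ℕ} (hp : p ≤ m) (t : KSub m) {r ρ : ℕ+} (hr : r < ρ)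
    (h1 : ∀ i : Fin m, (i : ℕ) < p → t i < r) (h2 : ∀ i : Fin m, p ≤ i → ρ < t i) :
    ∃ τ : KSub (m + 2), τ ⟨p, by omega⟩ = r ∧ τ ⟨p + 1, by omega⟩ = ρ ∧
      (skipPair m p).trans τ = t := by
  let f : Fin (m + 2) → ℕ+ := fun i =>
    if h : (i : ℕ) < p then t ⟨i, by omega⟩ else if h₀ : (i : ℕ) = p then r else
      if h' : (i : ℕ) = p + 1 then ρ else t ⟨i - 2, by omega⟩
  have hf : StrictMono f := by
    intro i j hij
    have hij' : (i : ℕ) < j := hij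
    simp only [f]
    split_ifs <;> first
      | omega
      | exact hr
      | exact h1 _ (by simpa using ‹_›)
      | exact h2 _ (by simp only; omega)
      | exact t.strictMono (by rw [Fin.lt_def]; simp only; omega)
      | exact (h1 _ (by simpa using ‹_›)).trans hr
      | exact hr.trans (h2 _ (by simp only; omega))
  refine ⟨OrderEmbedding.ofStrictMono f hf, ?_, ?_, ?_⟩
  · change f _ = r
    simp [f]
  · change f _ = ρ
    simp [f]
  · refine RelEmbedding.ext fun i => ?_
    change f (skipPair m p i) = t i
    rw [skipPair_apply]
    by_cases h : (i : ℕ) < p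
    · simp [f, h]
    · have h3 : ¬ (i : ℕ) + 2 < p := by omega
      have h4 : ¬ (i : ℕ) + 2 = p := by omega
      have h5 : ¬ (i : ℕ) + 2 = p + 1 := by omega
      simp [f, h, h3, h4, h5]

namespace FrakXPre

variable {k : ℕ}

/-- On a suitable infinite set `L`, the vector `x s` is small on those coordinates whose `q`-th
entry lies in a gap of `s`. -/
theorem exists_small_on_gaps {m : ℕ} (x : KSub m → FrakXPre k) {C ε : ℝ} (hε : 0 < ε)
    (hx : ∀ s, ‖x s‖ ≤ C) :
    ∃ L : ℕ+ ↪o ℕ+, ∀ (t : KSub m) (p : ℕ), p ≤ m → ∀ r ρ : ℕ+, r < ρ →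
      (∀ i : Fin m, (i : ℕ) < p → t i < r) → (∀ i : Fin m, p ≤ i → ρ < t i) →
      ∀ q, ‖restrict {σ | L r < σ q ∧ σ q ≤ L ρ} (x (t.trans L))‖ ≤ ε := by
  -- The colour records for which gap positions and which coordinates the restriction is small.
  let f : KSub (m + 2) → Set (Fin (m + 1) × Fin (k + 1)) := fun τ =>
    {pq | ‖restrict {σ | τ ⟨pq.1, by omega⟩ < σ pq.2 ∧ σ pq.2 ≤ τ ⟨pq.1 + 1, by omega⟩}
      (x ((skipPair m pq.1).trans τ))‖ ≤ ε}
  obtain ⟨L, c, hL⟩ := exists_homogeneous (m + 2) f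
  have key : ∀ (t : KSub m) (p : ℕ) (hp : p ≤ m) (r ρ : ℕ+), r < ρ →
      (∀ i : Fin m, (i : ℕ) < p → t i < r) → (∀ i : Fin m, p ≤ i → ρ < t i) →
      ∀ q, (‖restrict {σ | L r < σ q ∧ σ q ≤ L ρ} (x (t.trans L))‖ ≤ ε ↔
        ((⟨p, by omega⟩, q) : Fin (m + 1) × Fin (k + 1)) ∈ c) := by
    intro t p hp r ρ hr h1 h2 q
    obtain ⟨τ, e1, e2, rfl⟩ := exists_skipPair_eq hp t hr h1 h2
    rw [← hL τ, ← e1, ← e2]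
    rfl
  refine ⟨L, fun t p hp r ρ hr h1 h2 q => (key t p hp r ρ hr h1 h2 q).2 ?_⟩
  clear h1 h2 hr r ρ t
  by_contra hc
  -- If the homogeneous colour omits `(p, q)`, all such restrictions exceed `ε`. A set with room for
  -- `T` consecutive intervals in its gap `p` then violates the lower 2-estimate.
  obtain ⟨T, hT⟩ := exists_nat_gt (C ^ 2 / ε ^ 2)
  rw [div_lt_iff₀ (by positivity)] at hT
  let t : KSub m := OrderEmbedding.ofStrictMono
    (fun i => if (i : ℕ) < p then Nat.succPNat i else Nat.succPNat (T + p + 2 + i))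
    fun i j hij => by
      have : (i : ℕ) < j := hij
      simp only
      split_ifs <;> rw [Nat.succPNat_lt_succPNat] <;> omega
  let A : ℕ → Set (KSub (k + 1)) := fun l =>
    {σ | L (Nat.succPNat (p + l)) < σ q ∧ σ q ≤ L (Nat.succPNat (p + (l + 1)))}
  have hA : Pairwise (Function.onFun Disjoint A) := by
    rw [pairwise_disjoint_on]
    intro i j hij
    refine Set.disjoint_left.2 fun σ h1 h2 => ?_
    have : L (Nat.succPNat (p + (i + 1))) ≤ L (Nat.succPNat (p + j)) :=
      L.monotone (Nat.succPNat_le_succPNat.2 (by omega))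
    exact absurd (h1.2.trans this) (not_le.2 h2.1)
  have hsum := sum_norm_sq_restrict_le (Finset.range T) hA (x (t.trans L))
  have hlow : ∀ l ∈ Finset.range T, ε ^ 2 ≤ ‖restrict (A l) (x (t.trans L))‖ ^ 2 := by
    intro l hl
    have hl' := Finset.mem_range.1 hl
    refine pow_le_pow_left₀ hε.le (le_of_lt (not_le.1 fun h => hc ?_)) 2
    refine (key t p hp _ _ (Nat.succPNat_lt_succPNat.2 (by omega)) ?_ ?_ q).1 h
    · intro i hi
      change (if (i : ℕ) < p then _ else _) < _
      rw [if_pos hi]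
      exact Nat.succPNat_lt_succPNat.2 (by omega)
    · intro i hi
      change _ < (if (i : ℕ) < p then _ else _)
      rw [if_neg (not_lt.2 hi)]
      exact Nat.succPNat_lt_succPNat.2 (by omega)
  have h := (Finset.sum_le_sum hlow).trans hsum
  rw [Finset.sum_const, Finset.card_range, nsmul_eq_mul] at h
  have := pow_le_pow_left₀ (norm_nonneg _) (hx (t.trans L)) 2
  linarith

end FrakXPre

/-! ### Averages on coordinates with a large first entry -/

/-- The cut points separating the entries of the standard plegma family. -/
def cutPoint (l : ℕ) : ℕ+ := Nat.succPNat (2 * l)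

/-- The standard plegma family of length `N` in `[ℕ]^m`. -/
def stdPlegma (m N : ℕ) (j : Fin N) : KSub m :=
  OrderEmbedding.ofStrictMono (fun p => Nat.succPNat (2 * (p * N + j) + 1)) fun p p' h => by
    have h1 : (p : ℕ) < p' := h
    have h2 : (p : ℕ) * N < p' * N := Nat.mul_lt_mul_of_pos_right h1 (by have := j.2; omega)
    rw [Nat.succPNat_lt_succPNat]
    omega

theorem stdPlegma_apply {m N : ℕ} (j : Fin N) (p : Fin m) :
    stdPlegma m N j p = Nat.succPNat (2 * (p * N + j) + 1) := rfl

theorem cutPoint_strictMono : StrictMono cutPoint := fun i j h => by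
  rw [cutPoint, cutPoint, Nat.succPNat_lt_succPNat]; omega

theorem stdPlegma_lt_cutPoint {m N l : ℕ} {j : Fin N} {p : Fin m} (h : p * N + j < l) :
    stdPlegma m N j p < cutPoint l := by
  rw [stdPlegma_apply, cutPoint, Nat.succPNat_lt_succPNat]
  omega

theorem cutPoint_lt_stdPlegma {m N l : ℕ} {j : Fin N} {p : Fin m} (h : l ≤ p * N + j) :
    cutPoint l < stdPlegma m N j p := by
  rw [stdPlegma_apply, cutPoint, Nat.succPNat_lt_succPNat]
  omega

theorem stdPlegma_lt_stdPlegma {m N : ℕ} {j j' : Fin N} {p p' : Fin m}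
    (h : (p : ℕ) * N + j < p' * N + j') : stdPlegma m N j p < stdPlegma m N j' p' := by
  rw [stdPlegma_apply, stdPlegma_apply, Nat.succPNat_lt_succPNat]
  omega

theorem isPlegma_stdPlegma (m N : ℕ) : IsPlegma (stdPlegma m N) := by
  refine ⟨fun i j j' h => stdPlegma_lt_stdPlegma (Nat.add_lt_add_left h _), fun i i' h j j' => ?_⟩
  have h1 : ((i : ℕ) + 1) * N ≤ i' * N := Nat.mul_le_mul_right _ h
  rw [Nat.add_mul] at h1
  have := j.2
  exact stdPlegma_lt_stdPlegma (by omega)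

theorem IsPlegma.trans {m N : ℕ} {s : Fin N → KSub m} (hs : IsPlegma s) (L : ℕ+ ↪o ℕ+) :
    IsPlegma fun j => (s j).trans L :=
  ⟨fun i _ _ h => L.strictMono (hs.1 i h), fun i i' h j j' => L.strictMono (hs.2 i i' h j j')⟩

namespace FrakXPre

variable {k : ℕ}

/-- For each `j < N` consider those `σ` whose `k + 1` coordinates all lie in the `m ≤ k` intervals
`(R (p * N + j), R (p * N + j + 1)]`, `p < m`.  By the pigeonhole principle two coordinates of such
a `σ` share an interval, so that a Schreier plegmatic family meets at most `k + 1` of these sets. -/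
theorem card_meet_intervals_le {m N : ℕ} (hm : m ≤ k) {R : ℕ → ℕ+} (hR : Monotone R)
    {P : Finset (KSub (k + 1))} (hP : IsSchreierPlegmatic P) (J : Finset (Fin N))
    (hJ : ∀ j ∈ J, ∃ σ ∈ P, ∀ q, ∃ p < m, R (p * N + j) < σ q ∧ σ q ≤ R (p * N + j + 1)) :
    J.card ≤ k + 1 := by
  have h : ∀ j ∈ J, ∃ q q' : Fin (k + 1), q < q' ∧ ∃ σ ∈ P, ∃ p, R (p * N + j) < σ q ∧
      σ q' ≤ R (p * N + j + 1) := by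
    intro j hj
    obtain ⟨σ, hσ, h⟩ := hJ j hj
    choose p hpm hp using h
    obtain ⟨q, q', hne, e⟩ := Fintype.exists_ne_map_eq_of_card_lt
      (fun q => (⟨p q, hpm q⟩ : Fin m)) (by simpa using Nat.lt_succ_of_le hm)
    have e' : p q = p q' := congrArg Fin.val e
    rcases lt_or_gt_of_ne hne with hlt | hlt
    · exact ⟨q, q', hlt, σ, hσ, p q, (hp q).1, e' ▸ (hp q').2⟩
    · exact ⟨q', q, hlt, σ, hσ, p q, e' ▸ (hp q').1, (hp q).2⟩
  have : Nonempty (KSub (k + 1)) := ⟨stdPlegma (k + 1) 1 0⟩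
  choose! q q' hq σ hσ p hp using h
  -- The lower of the two coordinates determines `j`. With equal `q` and distinct intervals, the
  -- `q'`-th entry belonging to the earlier interval would lie below the `q`-th entry belonging to
  -- the later one, contradicting `hP.lt`.
  have hinj : Set.InjOn q J := by
    intro i hi j hj e
    have aux : ∀ i ∈ J, ∀ j ∈ J, q i = q j → ¬ p i * N + i < p j * N + j := by
      intro i hi j hj e hlt
      have h1 : σ i (q' i) < σ j (q j) :=
        ((hp i hi).2.trans (hR hlt)).trans_lt (hp j hj).1
      exact absurd h1 (not_lt.2 (hP.lt (hσ j hj) (hσ i hi) (e ▸ hq i hi)).le)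
    have h0 : p i * N + i = p j * N + j :=
      le_antisymm (not_lt.1 (aux j hj i hi e.symm)) (not_lt.1 (aux i hi j hj e))
    have h1 : (p i * N + i) % N = (p j * N + j) % N := congrArg (· % N) h0
    rw [Nat.mul_add_mod_self_right, Nat.mul_add_mod_self_right, Nat.mod_eq_of_lt i.2,
      Nat.mod_eq_of_lt j.2] at h1
    exact Fin.ext h1
  simpa using Finset.card_le_card_of_injOn q (fun j _ => Finset.mem_univ (q j)) hinj

theorem exists_coord_le (x : FrakXPre k) : ∃ B : ℕ+, ∀ σ, x.coeff σ ≠ 0 → ∀ q, σ q ≤ B := by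
  obtain ⟨B, hB⟩ := (x.finite_support.biUnion fun σ _ =>
    Set.finite_range fun q => (σ : KSub (k + 1)) q).bddAbove
  exact ⟨B, fun σ hσ q => hB (Set.mem_biUnion (show σ ∈ {s | x.coeff s ≠ 0} from hσ) ⟨q, rfl⟩)⟩

/-- A bounded `m`-sequence in `𝔛_{k+1}`, `m ≤ k`, has no `ℓ¹` behaviour on coordinates with a large
first entry. -/
theorem exists_norm_sum_tail_le {m : ℕ} (hm : m ≤ k) (x : KSub m → FrakXPre k) {C ε : ℝ}
    (hε : 0 < ε) (hx : ∀ s, ‖x s‖ ≤ C) :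
    ∃ (r₀ : ℕ+) (L : ℕ+ ↪o ℕ+), ∀ (L' : ℕ+ ↪o ℕ+) (N : ℕ) (a : Fin N → ℝ),
      (∀ j, |a j| ≤ 1 / N) →
      ‖∑ j, a j • restrict {σ | r₀ < σ 0} (x ((stdPlegma m N j).trans (L'.trans L)))‖ ≤
        ε + √((k + 1) * C ^ 2 / N) := by
  classical
  have hcpos : (0 : ℝ) < (m + 1) * (k + 1) := by positivity
  obtain ⟨L, hL⟩ := exists_small_on_gaps x (div_pos hε hcpos) hx
  -- The gap before the first entry is controlled only from `L 1` on, hence the cut there. The free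
  -- `L'` leaves room for another use of Ramsey's theorem.
  refine ⟨L 1, L, fun L' N a ha => ?_⟩
  set R : ℕ → ℕ+ := fun l => L (L' (cutPoint l))
  have hR : Monotone R := fun i j h =>
    L.monotone (L'.monotone (cutPoint_strictMono.monotone h))
  set y : Fin N → FrakXPre k := fun j => x ((stdPlegma m N j).trans (L'.trans L))
  let G : Fin N → Set (KSub (k + 1)) := fun j =>
    {σ | ∀ q, ∃ p < m, R (p * N + j) < σ q ∧ σ q ≤ R (p * N + j + 1)}
  let S : Set (KSub (k + 1)) := {σ | L 1 < σ 0}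
  have hsplit : ∀ j, restrict S (y j) = restrict (S ∩ G j) (y j) + restrict (S \ G j) (y j) := by
    intro j
    rw [restrict_add_of_disjoint (Set.disjoint_sdiff_right.mono_left Set.inter_subset_right),
      Set.inter_union_sdiff]
  have hbad : ∀ j, ‖restrict (S \ G j) (y j)‖ ≤ ε := by
    intro j
    obtain ⟨B, hB⟩ := exists_coord_le (y j)
    -- Gap `g` runs between the intervals numbered `g - 1` and `g`. The outermost gaps begin at `1`
    -- and end at a bound `B` for the support.
    let left : ℕ → ℕ+ := fun g => if g = 0 then 1 else L' (cutPoint ((g - 1) * N + j + 1))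
    let right : ℕ → ℕ+ := fun g => if g = m then B else L' (cutPoint (g * N + j))
    let D : Fin (m + 1) × Fin (k + 1) → Set (KSub (k + 1)) := fun gq =>
      {σ | L (left gq.1) < σ gq.2 ∧ σ gq.2 ≤ L (right gq.1)}
    have hcover : (S \ G j) ∩ {σ | (y j).coeff σ ≠ 0} ⊆ ⋃ gq ∈ Finset.univ, D gq := by
      rintro σ ⟨⟨hσS, hσG⟩, hσ⟩
      have hσG' : ∃ q, ∀ p < m, R (p * N + j) < σ q → R (p * N + j + 1) < σ q := by
        simpa [G] using hσG
      obtain ⟨q, hq⟩ := hσG'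
      -- For the least such `g`, the entry `σ q` is beyond the left end of interval `g - 1`; as it
      -- lies in no interval, it is beyond the right end too, hence in gap `g`.
      have hex : ∃ g, g ≤ m ∧ σ q ≤ L (right g) := ⟨m, le_rfl, by
        simp only [right, if_true]
        exact (hB σ hσ q).trans (L.strictMono.le_apply)⟩
      obtain ⟨hg1, hg2⟩ := Nat.find_spec hex
      have hmin := fun g' => Nat.find_min (m := g') hex
      set g := Nat.find hex
      simp only [Finset.mem_univ, Set.iUnion_true, Set.mem_iUnion]
      refine ⟨(⟨g, by omega⟩, q), ?_, hg2⟩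
      rcases Nat.eq_zero_or_pos g with h0 | hpos
      · simp only [left, h0, if_true]
        exact lt_of_lt_of_le hσS (σ.monotone (Fin.zero_le q))
      · have h1 := hmin (g - 1) (by omega)
        have h2 : g - 1 ≠ m := by omega
        simp only [right, h2, if_false, not_and, not_le] at h1
        have h3 := hq (g - 1) (by omega) (h1 (by omega))
        simpa only [left, hpos.ne', if_false] using h3
    have hD : ∀ gq, ‖restrict (D gq) (y j)‖ ≤ ε / ((m + 1) * (k + 1)) := by
      rintro ⟨⟨g, hg⟩, q⟩
      -- A gap may be degenerate, for instance when `N = 1` or `B` is small.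
      rcases le_or_gt (right g) (left g) with hle | hlt
      · have : D (⟨g, hg⟩, q) = ∅ := by
          refine Set.eq_empty_of_forall_notMem fun σ hσ => ?_
          exact absurd (hσ.1.trans_le hσ.2) (not_lt.2 (L.monotone hle))
        rw [this]
        have h0 : restrict (∅ : Set (KSub (k + 1))) (y j) = 0 := ext_coeff fun s => by
          rw [coeff_restrict, Set.indicator_empty]; rfl
        rw [h0, norm_zero]
        positivity
      · refine hL ((stdPlegma m N j).trans L') g (by omega) (left g) (right g) hlt ?_ ?_ q
        · intro i hi
          have h0 : g ≠ 0 := by omega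
          simp only [left, h0, if_false]
          refine L'.strictMono (stdPlegma_lt_cutPoint ?_)
          have : (i : ℕ) * N ≤ (g - 1) * N := Nat.mul_le_mul_right _ (by omega)
          omega
        · intro i hi
          have h0 : g ≠ m := by have := i.2; omega
          simp only [right, h0, if_false]
          refine L'.strictMono (cutPoint_lt_stdPlegma ?_)
          exact Nat.add_le_add_right (Nat.mul_le_mul_right _ hi) _
    calc ‖restrict (S \ G j) (y j)‖
        = ‖restrict ((S \ G j) ∩ {σ | (y j).coeff σ ≠ 0}) (y j)‖ := by
          rw [← restrict_restrict, restrict_eq_self (A := {σ | (y j).coeff σ ≠ 0}) fun s hs => hs]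
      _ ≤ ‖restrict (⋃ gq ∈ Finset.univ, D gq) (y j)‖ := norm_restrict_mono hcover _
      _ ≤ ∑ gq, ‖restrict (D gq) (y j)‖ := norm_restrict_biUnion_le _ _ _
      _ ≤ ∑ gq : Fin (m + 1) × Fin (k + 1), ε / ((m + 1) * (k + 1)) :=
          Finset.sum_le_sum fun gq _ => hD gq
      _ = ε := by
          rw [Finset.sum_const, Finset.card_univ, Fintype.card_prod, Fintype.card_fin,
            Fintype.card_fin, nsmul_eq_mul]
          push_cast
          field_simp
  have hgood : ‖∑ j, a j • restrict (S ∩ G j) (y j)‖ ≤ √((k + 1) * C ^ 2 / N) := by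
    refine (le_abs_self _).trans (Real.abs_le_sqrt ?_)
    refine (norm_sq_sum_le_of_card_meet_le (m := k + 1) (C := C) _
      (fun j => (norm_restrict_le _ _).trans (hx _)) ?_ a).trans ?_
    · intro P hP J hJ
      refine card_meet_intervals_le hm hR hP J fun j hj => ?_
      obtain ⟨σ, hσ, hne⟩ := hJ j hj
      rw [coeff_restrict] at hne
      exact ⟨σ, hσ, (Set.mem_of_indicator_ne_zero hne).2⟩
    · have h1 : ∑ j, a j ^ 2 ≤ ∑ _j : Fin N, ((1 / (N : ℝ)) ^ 2 : ℝ) :=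
        Finset.sum_le_sum fun j _ => by
          rw [← sq_abs]; exact pow_le_pow_left₀ (abs_nonneg _) (ha j) 2
      have h2 : ∑ _j : Fin N, ((1 / (N : ℝ)) ^ 2 : ℝ) = 1 / N := by
        rw [Finset.sum_const, Finset.card_univ, Fintype.card_fin, nsmul_eq_mul]
        rcases eq_or_ne (N : ℝ) 0 with h | h
        · simp [h]
        · field_simp
      rw [h2] at h1
      push_cast
      rw [div_eq_mul_one_div]
      exact mul_le_mul_of_nonneg_left h1 (by positivity)
  have hsum : ∑ j, a j • restrict S (y j) =
      ∑ j, a j • restrict (S \ G j) (y j) + ∑ j, a j • restrict (S ∩ G j) (y j) := by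
    rw [← Finset.sum_add_distrib]
    refine Finset.sum_congr rfl fun j _ => ?_
    rw [hsplit j, smul_add, add_comm]
  change ‖∑ j, a j • restrict S (y j)‖ ≤ _
  rw [hsum]
  refine (norm_add_le _ _).trans (add_le_add ?_ hgood)
  refine (norm_sum_le _ _).trans ?_
  calc ∑ j, ‖a j • restrict (S \ G j) (y j)‖ ≤ ∑ j : Fin N, 1 / (N : ℝ) * ε := by
        refine Finset.sum_le_sum fun j _ => ?_
        rw [norm_smul, Real.norm_eq_abs]
        exact mul_le_mul (ha j) (hbad j) (norm_nonneg _) (by positivity)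
    _ ≤ ε := by
        rw [Finset.sum_const, Finset.card_univ, Fintype.card_fin, nsmul_eq_mul, ← mul_assoc]
        rcases eq_or_ne (N : ℝ) 0 with h | h
        · simp [h, hε.le]
        · rw [mul_one_div_cancel h, one_mul]

end FrakXPre

/-! ### Coordinates with a small first entry, and small averages along plegma families -/

/-- A plegma pair consists of the alternate entries of one `2m`-set, so functions of plegma pairs
become functions on `2m`-sets. -/
theorem exists_interleave_eq {m : ℕ} :
    ∃ e o : Fin m ↪o Fin (2 * m), ∀ s t : KSub m, (∀ i, s i < t i) → (∀ i j, i < j → t i < s j) →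
      ∃ τ : KSub (2 * m), e.trans τ = s ∧ o.trans τ = t := by
  refine ⟨OrderEmbedding.ofStrictMono (fun i => ⟨2 * i, by omega⟩) fun i j h => ?_,
    OrderEmbedding.ofStrictMono (fun i => ⟨2 * i + 1, by omega⟩) fun i j h => ?_,
    fun s t h1 h2 => ?_⟩
  · have : (i : ℕ) < j := h
    rw [Fin.lt_def]; simp only; omega
  · have : (i : ℕ) < j := h
    rw [Fin.lt_def]; simp only; omega
  let f : Fin (2 * m) → ℕ+ := fun i =>
    if (i : ℕ) % 2 = 0 then s ⟨i / 2, by omega⟩ else t ⟨i / 2, by omega⟩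
  have h3 : ∀ i j, i ≤ j → s i < t j := fun i j h => (h1 i).trans_le (t.monotone h)
  have hf : StrictMono f := by
    intro i j hij
    have hij' : (i : ℕ) < j := hij
    simp only [f]
    split_ifs
    · exact s.strictMono (by rw [Fin.lt_def]; simp only; omega)
    · exact h3 _ _ (by rw [Fin.le_def]; simp only; omega)
    · exact h2 _ _ (by rw [Fin.lt_def]; simp only; omega)
    · exact t.strictMono (by rw [Fin.lt_def]; simp only; omega)
  refine ⟨OrderEmbedding.ofStrictMono f hf, ?_, ?_⟩
  · refine RelEmbedding.ext fun i => ?_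
    change f ⟨2 * i, _⟩ = s i
    simp [f]
  · refine RelEmbedding.ext fun i => ?_
    change f ⟨2 * i + 1, _⟩ = t i
    have : (2 * (i : ℕ) + 1) / 2 = i := by omega
    simp [f, Nat.add_mod, this]

/-- The shift `i ↦ n + i` of the positive integers. -/
def addLeftEmb (n : ℕ+) : ℕ+ ↪o ℕ+ :=
  OrderEmbedding.ofStrictMono (fun i => n + i) fun _ _ h => add_lt_add_right h n

theorem lt_addLeftEmb_trans (n : ℕ+) (L : ℕ+ ↪o ℕ+) (i : ℕ+) : n < (addLeftEmb n).trans L i :=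
  (PNat.lt_add_right n i).trans_le L.strictMono.le_apply

namespace FrakXPre

variable {k : ℕ}

/-- Subtracting `c` from every inner product leaves the quadratic form unchanged; what remains is at
most `η` on average, plus `D / N` from the diagonal. The product form of `hc` covers both signed
averages, where `∑ j, a j = 0`, and disjoint supports, where `c = 0`. -/
theorem norm_sq_sum_le_of_ip_near {N r : ℕ} {u : Fin N → FrakXPre k} {a : Fin N → ℝ} {c η D : ℝ}
    (hu : ∀ j s, (u j).coeff s ≠ 0 → (s 0 : ℕ) ≤ r) (hη : 0 ≤ η)
    (ha : ∀ j, |a j| ≤ 1 / N) (hc : c * ∑ j, a j = 0)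
    (hdiag : ∀ j, |ip (u j) (u j) - c| ≤ η + D)
    (hoff : ∀ i j, i < j → |ip (u i) (u j) - c| ≤ η) :
    ‖∑ j, a j • u j‖ ^ 2 ≤ r ^ (k + 1) * (η + D / N) := by
  classical
  rcases Nat.eq_zero_or_pos N with rfl | hN
  · simp only [Finset.univ_eq_empty, Finset.sum_empty, norm_zero, ne_eq, OfNat.ofNat_ne_zero,
      not_false_eq_true, zero_pow, CharP.cast_eq_zero, div_zero, add_zero]
    positivity
  have hN' : (N : ℝ) ≠ 0 := by positivity
  have hsupp : ∀ s, (∑ j, a j • u j).coeff s ≠ 0 → (s 0 : ℕ) ≤ r := by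
    intro s hs
    rw [coeff_sum] at hs
    obtain ⟨j, -, hj⟩ := Finset.exists_ne_zero_of_sum_ne_zero hs
    rw [coeff_smul] at hj
    exact hu j s (right_ne_zero_of_mul hj)
  refine (norm_sq_le_ip hsupp).trans (mul_le_mul_of_nonneg_left ?_ (by positivity))
  have hbound : ∀ i j, |ip (u i) (u j) - c| ≤ η + if i = j then D else 0 := by
    intro i j
    split_ifs with h
    · rw [← h]; exact hdiag i
    · rw [add_zero]
      rcases lt_or_gt_of_ne h with h | h
      · exact hoff i j h
      · rw [ip_comm]; exact hoff j i h
  calc ip (∑ j, a j • u j) (∑ j, a j • u j)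
      = ∑ i, ∑ j, a i * a j * ip (u i) (u j) := by
        simp only [map_sum, map_smul, LinearMap.sum_apply, LinearMap.smul_apply, smul_eq_mul,
          Finset.mul_sum]
        rw [Finset.sum_comm]
        exact Finset.sum_congr rfl fun i _ => Finset.sum_congr rfl fun j _ => by ring
    _ = ∑ i, ∑ j, a i * a j * (ip (u i) (u j) - c) := by
        have h0 : ∑ i, ∑ j, a i * a j * c = 0 := by
          have : ∑ i, ∑ j, a i * a j * c = (c * ∑ j, a j) * ∑ j, a j := by
            simp only [Finset.mul_sum, Finset.sum_mul]
            exact Finset.sum_congr rfl fun i _ => Finset.sum_congr rfl fun j _ => by ring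
          rw [this, hc, zero_mul]
        simp only [mul_sub, Finset.sum_sub_distrib, h0, sub_zero]
    _ ≤ ∑ i : Fin N, ∑ j : Fin N, 1 / (N : ℝ) * (1 / N) * (η + if i = j then D else 0) := by
        refine Finset.sum_le_sum fun i _ => Finset.sum_le_sum fun j _ => ?_
        refine (le_abs_self _).trans ?_
        rw [abs_mul, abs_mul]
        exact mul_le_mul (mul_le_mul (ha i) (ha j) (abs_nonneg _) (by positivity)) (hbound i j)
          (abs_nonneg _) (by positivity)
    _ = η + D / N := by
        simp only [mul_add, Finset.sum_add_distrib, mul_ite, mul_zero, Finset.sum_ite_eq,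
          Finset.mem_univ, if_true, Finset.sum_const, Finset.card_univ, Fintype.card_fin,
          nsmul_eq_mul]
        field_simp

/-- Combines the tail and head estimates. The length `N` does not depend on `n`, as the definition
of a spreading model requires a late start for a given length. -/
theorem exists_plegma_norm_sum_le {m : ℕ} (hm : m ≤ k) (x : KSub m → FrakXPre k) {C ε : ℝ}
    (hε : 0 < ε) (hx : ∀ s, ‖x s‖ ≤ C) :
    ∃ N : ℕ, 0 < N ∧ ∀ n : ℕ+, ∃ s : Fin N → KSub m, IsPlegma s ∧ (∀ j i, n ≤ s j i) ∧
      ∃ a : Fin N → ℝ, (∀ j, |a j| = 1 / N) ∧ ‖∑ j, a j • x (s j)‖ ≤ ε := by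
  obtain ⟨r, L, hL⟩ := exists_norm_sum_tail_le hm x (ε := ε / 3) (by positivity) hx
  -- The two thresholds make the square-root term of the tail and the head each at most `ε / 3`; `1
  -- + 2 * C ^ 2` comes from `η = 1 / N` and `D = 2 * C ^ 2`.
  obtain ⟨K, hK⟩ := exists_nat_gt (max (((k : ℝ) + 1) * C ^ 2 / (ε / 3) ^ 2)
    ((r : ℝ) ^ (k + 1) * (1 + 2 * C ^ 2) / (ε / 3) ^ 2))
  obtain ⟨hK1, hK2⟩ := max_lt_iff.1 hK
  have hKpos : (0 : ℝ) < K := lt_of_le_of_lt (by positivity) hK1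
  have hKpos' : 0 < K := by exact_mod_cast hKpos
  obtain ⟨e, o, heo⟩ := exists_interleave_eq (m := m)
  let S : Set (KSub (k + 1)) := {σ | r < σ 0}
  let u : KSub m → FrakXPre k := fun s => restrict Sᶜ (x s)
  have hu : ∀ s, ‖u s‖ ≤ C := fun s => (norm_restrict_le _ _).trans (hx s)
  have hNpos : (0 : ℝ) < ((K + K : ℕ) : ℝ) := by push_cast; linarith
  obtain ⟨L', c, hc⟩ := exists_homogeneous_approx (η := 1 / ((K + K : ℕ) : ℝ))
    (fun τ : KSub (2 * m) => ip (u ((e.trans τ).trans L)) (u ((o.trans τ).trans L)))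
    (by positivity) (fun τ => abs_ip_le (hu _) (hu _))
  -- Any single value of the homogenised function bounds `c`; this is needed on the diagonal, which
  -- Ramsey's theorem does not control.
  have hcC : |c| ≤ 1 / ((K + K : ℕ) : ℝ) + C ^ 2 := by
    have h1 := hc (stdPlegma (2 * m) 1 0)
    have h2 := abs_ip_le (hu ((e.trans ((stdPlegma (2 * m) 1 0).trans L')).trans L))
      (hu ((o.trans ((stdPlegma (2 * m) 1 0).trans L')).trans L))
    rw [abs_le] at h1 h2 ⊢
    constructor <;> linarith
  refine ⟨K + K, by omega, fun n => ?_⟩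
  let Ln : ℕ+ ↪o ℕ+ := (addLeftEmb n).trans L'
  let s : Fin (K + K) → KSub m := fun j => (stdPlegma m (K + K) j).trans (Ln.trans L)
  -- Alternating signs over an even number of terms sum to zero, while the `ℓ¹`-norm of `a` is 1.
  let a : Fin (K + K) → ℝ := fun j => (-1) ^ (j : ℕ) * (1 / ((K + K : ℕ) : ℝ))
  have ha : ∀ j, |a j| = 1 / ((K + K : ℕ) : ℝ) := fun j => by
    rw [abs_mul, abs_pow, abs_neg, abs_one, one_pow, one_mul, abs_of_nonneg (by positivity)]
  have hasum : ∑ j, a j = 0 := by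
    rw [← Finset.sum_mul, Fin.sum_univ_eq_sum_range (fun j => (-1 : ℝ) ^ j), neg_one_geom_sum,
      if_pos ⟨K, rfl⟩, zero_mul]
  refine ⟨s, (isPlegma_stdPlegma m _).trans _, fun j i => ?_, a, ha, ?_⟩
  · exact ((lt_addLeftEmb_trans n L' _).trans_le L.strictMono.le_apply).le
  have htail := hL Ln (K + K) a (fun j => (ha j).le)
  have hpair : ∀ i j, i < j → |ip (u (s i)) (u (s j)) - c| ≤ 1 / ((K + K : ℕ) : ℝ) := by
    intro i j hij
    obtain ⟨τ, h1, h2⟩ := heo ((stdPlegma m (K + K) i).trans (addLeftEmb n))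
      ((stdPlegma m (K + K) j).trans (addLeftEmb n))
      (fun p => (((isPlegma_stdPlegma m (K + K)).trans (addLeftEmb n)).1 p) hij)
      (fun p p' h => ((isPlegma_stdPlegma m (K + K)).trans (addLeftEmb n)).2 p p' h j i)
    have h := hc τ
    have e1 : (e.trans (τ.trans L')).trans L = s i := by
      change ((e.trans τ).trans L').trans L = s i
      rw [h1]; rfl
    have e2 : (o.trans (τ.trans L')).trans L = s j := by
      change ((o.trans τ).trans L').trans L = s j
      rw [h2]; rfl
    rwa [e1, e2] at h
  have hdiag : ∀ j, |ip (u (s j)) (u (s j)) - c| ≤ 1 / ((K + K : ℕ) : ℝ) + 2 * C ^ 2 := by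
    intro j
    have h2 := abs_ip_le (hu (s j)) (hu (s j))
    rw [abs_le] at h2 hcC ⊢
    constructor <;> linarith
  have hhead : ‖∑ j, a j • u (s j)‖ ≤ ε / 3 := by
    refine le_of_sq_le_sq ((norm_sq_sum_le_of_ip_near (r := r) (fun j σ hσ => ?_) (by positivity)
      (fun j => (ha j).le) (by rw [hasum, mul_zero]) hdiag hpair).trans ?_) (by positivity)
    · rw [coeff_restrict] at hσ
      exact PNat.coe_le_coe _ _ |>.2 (not_lt.1 (Set.mem_of_indicator_ne_zero hσ))
    · rw [div_lt_iff₀ (by positivity)] at hK2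
      rw [← add_div, ← mul_div_assoc, div_le_iff₀ hNpos]
      have : (0 : ℝ) ≤ (ε / 3) ^ 2 * K := by positivity
      push_cast
      linarith
  have hsqrt : √((k + 1) * C ^ 2 / ((K + K : ℕ) : ℝ)) ≤ ε / 3 := by
    rw [Real.sqrt_le_left (by positivity), div_le_iff₀ hNpos]
    rw [div_lt_iff₀ (by positivity)] at hK1
    have : (0 : ℝ) ≤ (ε / 3) ^ 2 * K := by positivity
    push_cast
    linarith
  have hsum : ∑ j, a j • x (s j) = ∑ j, a j • restrict S (x (s j)) + ∑ j, a j • u (s j) := by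
    rw [← Finset.sum_add_distrib]
    exact Finset.sum_congr rfl fun j _ => by rw [← smul_add, restrict_add_compl]
  rw [hsum]
  refine (norm_add_le _ _).trans ?_
  change ‖∑ j, a j • restrict S (x (s j))‖ ≤ _ at htail
  linarith

end FrakXPre

/-! ### No `ℓ¹` spreading models of order at most `k` -/

/-- Replacing each `x s` by a finitely supported vector within `ε / 2` costs at most `ε / 2`, since
the coefficients have `ℓ¹`-norm 1. -/
theorem FrakX.exists_plegma_norm_sum_le {k m : ℕ} (hm : m ≤ k) (x : KSub m → FrakX k) {C ε : ℝ}
    (hε : 0 < ε) (hx : ∀ s, ‖x s‖ ≤ C) :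
    ∃ N : ℕ, 0 < N ∧ ∀ n : ℕ+, ∃ s : Fin N → KSub m, IsPlegma s ∧ (∀ j i, n ≤ s j i) ∧
      ∃ a : Fin N → ℝ, (∀ j, |a j| = 1 / N) ∧ ‖∑ j, a j • x (s j)‖ ≤ ε := by
  have happ : ∀ s, ∃ y : FrakXPre k, ‖x s - (y : FrakX k)‖ < ε / 2 := fun s => by
    simpa only [dist_eq_norm] using
      UniformSpace.Completion.denseRange_coe.exists_dist_lt (x s) (half_pos hε)
  choose y hy using happ
  have hyC : ∀ s, ‖y s‖ ≤ C + ε / 2 := fun s => by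
    rw [← UniformSpace.Completion.norm_coe]
    have h1 := norm_sub_norm_le (y s : FrakX k) (x s)
    have h2 := hy s
    rw [norm_sub_rev] at h2
    have := hx s
    linarith
  obtain ⟨N, hN, h⟩ := FrakXPre.exists_plegma_norm_sum_le hm y (half_pos hε) hyC
  refine ⟨N, hN, fun n => ?_⟩
  obtain ⟨s, hs, hn, a, ha, hle⟩ := h n
  refine ⟨s, hs, hn, a, ha, ?_⟩
  have hsplit : ∑ j, a j • x (s j) = ∑ j, a j • (x (s j) - (y (s j) : FrakX k)) +
      ((∑ j, a j • y (s j) : FrakXPre k) : FrakX k) := by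
    have : ((∑ j, a j • y (s j) : FrakXPre k) : FrakX k) = ∑ j, a j • (y (s j) : FrakX k) := by
      change UniformSpace.Completion.toComplL (𝕜 := ℝ) _ = _
      rw [map_sum]
      exact Finset.sum_congr rfl fun j _ => map_smul _ _ _
    rw [this, ← Finset.sum_add_distrib]
    exact Finset.sum_congr rfl fun j _ => by rw [← smul_add, sub_add_cancel]
  rw [hsplit]
  refine (norm_add_le _ _).trans ?_
  rw [UniformSpace.Completion.norm_coe]
  have h1 : ‖∑ j, a j • (x (s j) - (y (s j) : FrakX k))‖ ≤ ε / 2 := by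
    refine (norm_sum_le _ _).trans ?_
    calc ∑ j, ‖a j • (x (s j) - (y (s j) : FrakX k))‖ ≤ ∑ j : Fin N, 1 / (N : ℝ) * (ε / 2) := by
          refine Finset.sum_le_sum fun j _ => ?_
          rw [norm_smul, Real.norm_eq_abs, ha j]
          exact mul_le_mul_of_nonneg_left (hy _).le (by positivity)
      _ = ε / 2 := by
          rw [Finset.sum_const, Finset.card_univ, Fintype.card_fin, nsmul_eq_mul]
          have : (N : ℝ) ≠ 0 := by positivity
          field_simp
  linarith

theorem ellOneNorm_sum (n : ℕ) (a : Fin n → ℝ) :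
    ellOneNorm (∑ i, a i • ellOneBasis i) = ∑ i, |a i| := by
  classical
  have h : (∑ i, a i • ellOneBasis i : lp (fun _ : ℕ => ℝ) 1) =
      ∑ i ∈ Finset.range n, lp.single 1 i (if h : i < n then a ⟨i, h⟩ else 0) := by
    rw [Finset.sum_range]
    refine Finset.sum_congr rfl fun i _ => ?_
    rw [dif_pos i.2, ellOneBasis, ← lp.single_smul, smul_eq_mul, mul_one]
  have h1 := lp.norm_sum_single (p := 1) (E := fun _ : ℕ => ℝ) (by norm_num)
    (fun i => if h : i < n then a ⟨i, h⟩ else 0) (Finset.range n)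
  simp only [ENNReal.toReal_one, Real.rpow_one] at h1
  change ‖(_ : lp (fun _ : ℕ => ℝ) 1)‖ = _
  rw [h, h1, Finset.sum_range]
  exact Finset.sum_congr rfl fun i _ => by rw [dif_pos i.2, Real.norm_eq_abs]

theorem FrakX.not_equivalentSeq_ellOne {k m : ℕ} (hm : m ≤ k) {E : Type*} [AddCommGroup E]
    [Module ℝ E] (p : Seminorm ℝ E) (e : Module.Basis ℕ ℝ E)
    (h : IsSpreadingModelOf (FrakX k) m p e) : ¬ EquivalentSeq p e ellOneNorm ellOneBasis := by
  rintro ⟨c, C, hc, hcC, heq⟩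
  obtain ⟨x, M, δ, hδ, hδ0, hgen⟩ := h
  have hC : 0 < C := hc.trans_le hcC
  -- Plegma families of length one show that a generating family is bounded on `[M]^m`.
  have hbd : ∀ s : KSub m, ‖x (s.trans M)‖ ≤ p (e 0) + δ 1 := by
    intro s
    have h1 := hgen 1 1 le_rfl (fun _ => s.trans M)
      ⟨fun i j j' hjj => absurd (Subsingleton.elim j j') hjj.ne,
        fun i i' hi j j' => M.strictMono (s.strictMono hi)⟩
      (fun j i => ⟨s i, rfl⟩) (fun j i => M.monotone (one_le)) (fun _ => 1)
      (fun j => by norm_num)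
    simp only [Finset.univ_unique, Finset.sum_singleton, one_smul] at h1
    have h2 := (abs_le.1 h1).2
    have h3 : p (e ((default : Fin 1) : ℕ)) = p (e 0) := rfl
    linarith
  obtain ⟨N, hN, hsmall⟩ := exists_plegma_norm_sum_le hm (fun s => x (s.trans M))
    (ε := 1 / (4 * C)) (by positivity) hbd
  -- With `N` fixed, a late start makes the spreading model error at most `1 / (4 * C)`. Equivalence
  -- would then give `1 ≤ C * (1 / (2 * C))`.
  obtain ⟨n, hn1, hn2⟩ : ∃ n : ℕ+, N ≤ n ∧ δ n ≤ 1 / (4 * C) := by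
    have h1 : ∀ᶠ n : ℕ+ in atTop, δ n ≤ 1 / (4 * C) :=
      (hδ0.eventually (gt_mem_nhds (by positivity))).mono fun n hn => le_of_lt hn
    obtain ⟨n, h2, h3⟩ := (h1.and (eventually_ge_atTop (⟨N, hN⟩ : ℕ+))).exists
    exact ⟨n, h3, h2⟩
  obtain ⟨s, hs, hns, a, ha, hle⟩ := hsmall n
  have hN0 : (N : ℝ) ≠ 0 := by positivity
  have h1 := hgen N n hn1 (fun j => (s j).trans M) (hs.trans M) (fun j i => ⟨s j i, rfl⟩)
    (fun j i => M.monotone (hns j i)) a fun j => by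
      rw [Set.mem_Icc, ← abs_le, ha j]
      rw [div_le_one (by positivity)]
      exact_mod_cast hN
  have h2 := (heq N a).2
  rw [ellOneNorm_sum] at h2
  have h3 : ∑ i, |a i| = 1 := by
    rw [Finset.sum_congr rfl fun i _ => ha i, Finset.sum_const, Finset.card_univ,
      Fintype.card_fin, nsmul_eq_mul]
    field_simp
  rw [h3] at h2
  have h4 := (abs_le.1 h1).1
  have h5 : p (∑ i, a i • e i) ≤ 1 / (2 * C) := by
    have : 1 / (2 * C) = 1 / (4 * C) + 1 / (4 * C) := by field_simp; norm_num
    linarith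
  have h6 := mul_le_mul_of_nonneg_left h5 hC.le
  have h7 : C * (1 / (2 * C)) = 1 / 2 := by field_simp
  linarith

/-! ### The unit vectors: basis, spreading model and Cesàro averages -/

namespace FrakXPre

variable {k : ℕ}

theorem coeff_unit (s t : KSub (k + 1)) [Decidable (s = t)] :
    (unit k s).coeff t = if s = t then 1 else 0 := by
  classical
  exact (Finsupp.single_apply).trans (by congr)

theorem sum_coeff_smul_unit (A : Finset (KSub (k + 1))) (x : FrakXPre k) :
    ∑ s ∈ A, x.coeff s • unit k s = restrict (A : Set (KSub (k + 1))) x := by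
  classical
  refine ext_coeff fun t => ?_
  rw [coeff_sum, coeff_restrict]
  simp only [coeff_smul, coeff_unit, mul_ite, mul_one, mul_zero, Finset.sum_ite_eq',
    Set.indicator_apply, Finset.mem_coe]

/-- At most one of several disjoint families contains `s`. -/
theorem norm_unit_le (s : KSub (k + 1)) : ‖unit k s‖ ≤ 1 := by
  classical
  refine le_of_sq_le_sq (norm_sq_le fun n P _ hd => ?_) zero_le_one
  have h1 : ∀ Q, partNorm Q (unit k s) = if s ∈ Q then 1 else 0 := by
    intro Q
    unfold partNorm
    simp only [coeff_unit, apply_ite abs, abs_one, abs_zero, Finset.sum_ite_eq]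
  have h2 : ∀ i, partNorm (P i) (unit k s) ^ 2 = partNorm (P i) (unit k s) := by
    intro i
    rw [h1]
    split_ifs <;> norm_num
  have h3 : ∑ i, partNorm (P i) (unit k s) = partNorm (Finset.univ.biUnion P) (unit k s) := by
    unfold partNorm
    rw [Finset.sum_biUnion fun i _ j _ hij => hd hij]
  rw [Finset.sum_congr rfl fun i _ => h2 i, h3, h1]
  split_ifs <;> norm_num

theorem partNorm_le_norm {P : Finset (KSub (k + 1))} (hP : IsSchreierPlegmatic P)
    (x : FrakXPre k) : partNorm P x ≤ ‖x‖ := by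
  have h := sum_partNorm_sq_le (ι := Unit) (P := fun _ => P) x (fun _ => hP)
    fun i j hij => absurd rfl hij
  simp only [Finset.univ_unique, Finset.sum_singleton] at h
  exact le_of_sq_le_sq h (norm_nonneg x)

/-- A plegma family of length `m` whose entries are at least `m` is isometrically the basis of
`ℓ¹_m`. -/
theorem norm_sum_unit_of_isPlegma {m : ℕ} {s : Fin m → KSub (k + 1)} (hs : IsPlegma s)
    (hm : ∀ j i, m ≤ (s j i : ℕ)) (a : Fin m → ℝ) :
    ‖∑ j, a j • unit k (s j)‖ = ∑ j, |a j| := by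
  classical
  have hinj : ∀ i, Function.Injective fun j => s j i := fun i => (hs.1 i).injective
  have hsinj : Function.Injective s := fun j j' h => hinj 0 (by simp only [h])
  refine le_antisymm ?_ ?_
  · refine (norm_sum_le _ _).trans (Finset.sum_le_sum fun j _ => ?_)
    rw [norm_smul, Real.norm_eq_abs]
    exact mul_le_of_le_one_right (abs_nonneg _) (norm_unit_le _)
  · have hP : IsSchreierPlegmatic (Finset.univ.image s) := by
      refine ⟨fun i => Finset.univ.image fun j => s j i, ?_, ?_, ?_, ?_⟩
      · intro i i' h a ha b hb
        obtain ⟨j, -, rfl⟩ := Finset.mem_image.1 ha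
        obtain ⟨j', -, rfl⟩ := Finset.mem_image.1 hb
        exact hs.2 i i' h j j'
      · intro i
        rw [Finset.card_image_of_injective _ (hinj i), Finset.card_image_of_injective _ (hinj 0)]
      · intro t ht i
        obtain ⟨j, -, rfl⟩ := Finset.mem_image.1 ht
        exact Finset.mem_image_of_mem _ (Finset.mem_univ j)
      · intro b hb
        obtain ⟨j, -, rfl⟩ := Finset.mem_image.1 hb
        rw [Finset.card_image_of_injective _ (hinj 0), Finset.card_univ, Fintype.card_fin]
        exact hm j 0
    refine le_trans (le_of_eq ?_) (partNorm_le_norm hP _)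
    unfold partNorm
    rw [Finset.sum_image hsinj.injOn]
    refine Finset.sum_congr rfl fun j _ => ?_
    rw [coeff_sum]
    simp only [coeff_smul, coeff_unit, hsinj.eq_iff, mul_ite, mul_one, mul_zero,
      Finset.sum_ite_eq', Finset.mem_univ, if_true]

end FrakXPre

namespace FrakX

variable {k : ℕ}

/-- The embedding of `c₀₀` into its completion. -/
noncomputable def ofPre : FrakXPre k →L[ℝ] FrakX k := UniformSpace.Completion.toComplL

theorem ofPre_unit (s : KSub (k + 1)) : ofPre (FrakXPre.unit k s) = frakXBasis k s := rfl

theorem norm_ofPre (x : FrakXPre k) : ‖(ofPre x : FrakX k)‖ = ‖x‖ :=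
  UniformSpace.Completion.norm_coe x

theorem denseRange_ofPre : DenseRange (ofPre : FrakXPre k → FrakX k) :=
  UniformSpace.Completion.denseRange_coe

/-- The coordinate functionals of `𝔛_{k+1}`. -/
noncomputable def coord (s : KSub (k + 1)) : StrongDual ℝ (FrakX k) :=
  ((FrakXPre.coeffₗ s).mkContinuous 1 fun x => by
    rw [one_mul]; exact FrakXPre.abs_coeff_le_norm x s).extend ofPre

theorem coord_ofPre (s : KSub (k + 1)) (x : FrakXPre k) : coord s (ofPre x) = x.coeff s :=
  ContinuousLinearMap.extend_eq _ denseRange_ofPre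
    (UniformSpace.Completion.isUniformInducing_coe _) x

/-- The coordinate projections of `𝔛_{k+1}`. -/
noncomputable def proj (A : Finset (KSub (k + 1))) : FrakX k →L[ℝ] FrakX k :=
  ∑ s ∈ A, (coord s).smulRight (frakXBasis k s)

theorem proj_apply (A : Finset (KSub (k + 1))) (x : FrakX k) :
    proj A x = ∑ s ∈ A, coord s x • frakXBasis k s := by
  simp [proj]

theorem proj_ofPre (A : Finset (KSub (k + 1))) (x : FrakXPre k) :
    proj A (ofPre x) = ofPre (FrakXPre.restrict (A : Set (KSub (k + 1))) x) := by
  rw [proj_apply, ← FrakXPre.sum_coeff_smul_unit, map_sum]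
  refine Finset.sum_congr rfl fun s _ => ?_
  rw [map_smul, coord_ofPre, ofPre_unit]

theorem norm_proj_apply_le (A : Finset (KSub (k + 1))) (x : FrakX k) : ‖proj A x‖ ≤ ‖x‖ := by
  refine denseRange_ofPre.induction_on (p := fun x => ‖proj A x‖ ≤ ‖x‖) x
    (isClosed_le (proj A).continuous.norm continuous_norm) fun y => ?_
  rw [proj_ofPre, norm_ofPre, norm_ofPre]
  exact FrakXPre.norm_restrict_le _ _

theorem tendsto_proj (x : FrakX k) : Tendsto (fun A => proj A x) atTop (𝓝 x) := by
  rw [Metric.tendsto_atTop]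
  intro ε hε
  obtain ⟨y, hy⟩ := denseRange_ofPre.exists_dist_lt x (half_pos hε)
  refine ⟨y.finite_support.toFinset, fun A hA => ?_⟩
  have h1 : proj A (ofPre y) = ofPre y := by
    rw [proj_ofPre, FrakXPre.restrict_eq_self fun s hs => hA (by simpa using hs)]
  rw [dist_eq_norm] at hy ⊢
  have h2 : proj A x - x = proj A (x - ofPre y) - (x - ofPre y) := by
    rw [map_sub, h1]; abel
  rw [h2]
  have h3 := norm_sub_le (proj A (x - ofPre y)) (x - ofPre y)
  have h4 := norm_proj_apply_le A (x - ofPre y)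
  linarith

theorem hasSum_coord (x : FrakX k) : HasSum (fun s => coord s x • frakXBasis k s) x := by
  have h := tendsto_proj x
  simp only [proj_apply] at h
  exact h

theorem exists_unconditionalSchauderBasis (k : ℕ) :
    ∃ b : UnconditionalSchauderBasis (KSub (k + 1)) ℝ (FrakX k),
      ∀ s, b.basis s = frakXBasis k s :=
  ⟨{ basis := frakXBasis k
     coord := coord
     ortho := fun i j => by
       classical
       rw [← ofPre_unit, coord_ofPre, FrakXPre.coeff_unit]
       by_cases h : j = i
       · subst h
         exact (if_pos rfl).trans (@Pi.single_eq_same _ (fun _ => ℝ) _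
           (fun a b => Classical.propDecidable (a = b)) _ _).symm
       · exact (if_neg h).trans (@Pi.single_eq_of_ne _ (fun _ => ℝ) _
           (fun a b => Classical.propDecidable (a = b)) _ _ (Ne.symm h) _).symm
     expansion := hasSum_coord }, fun _ => rfl⟩

theorem exists_spreadingModel_ellOne (k : ℕ) :
    ∃ (E : Type) (_ : AddCommGroup E) (_ : Module ℝ E) (p : Seminorm ℝ E)
      (e : Module.Basis ℕ ℝ E),
      GeneratesSpreadingModel (k + 1) (frakXBasis k) (RelEmbedding.refl _) p e ∧
      IsometricSeq p e ellOneNorm ellOneBasis := by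
  -- The unit vectors are not a Hamel basis of `ℓ¹`, so its norm is pulled back to the finitely
  -- supported sequences.
  let p : Seminorm ℝ (ℕ →₀ ℝ) := ellOneNorm.comp (Finsupp.linearCombination ℝ ellOneBasis)
  have hp : ∀ (n : ℕ) (a : Fin n → ℝ), p (∑ i, a i • Finsupp.basisSingleOne (R := ℝ) (i : ℕ)) =
      ellOneNorm (∑ i, a i • ellOneBasis i) := by
    intro n a
    simp only [p, Seminorm.comp_apply, map_sum, map_smul, Finsupp.coe_basisSingleOne,
      Finsupp.linearCombination_single, one_smul]
  refine ⟨ℕ →₀ ℝ, inferInstance, inferInstance, p, Finsupp.basisSingleOne, ?_, hp⟩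
  refine ⟨fun n => 1 / (n : ℝ), fun n => by positivity, ?_, ?_⟩
  · have : Tendsto (fun n : ℕ+ => ((n : ℕ) : ℝ)) atTop atTop :=
      tendsto_natCast_atTop_atTop.comp tendsto_PNat_val_atTop_atTop
    simpa only [one_div] using! tendsto_inv_atTop_zero.comp this
  · intro m n hmn s hs _ hns a _
    have h1 : ‖∑ j, a j • frakXBasis k (s j)‖ = ∑ j, |a j| := by
      rw [← FrakXPre.norm_sum_unit_of_isPlegma hs
        (fun j i => hmn.trans (PNat.coe_le_coe _ _ |>.2 (hns j i))) a, ← norm_ofPre, map_sum]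
      simp only [map_smul, ofPre_unit]
    rw [h1, hp, ellOneNorm_sum, sub_self, abs_zero]
    positivity

/-- The unit vectors indexed by `(k+1)`-subsets of `M|n` have averages bounded away from zero for
`n` a multiple of `k + 2`. -/
theorem le_norm_cesaro (M : ℕ+ ↪o ℕ+) (m : ℕ+) {n : ℕ+} (hn : (n : ℕ) = (k + 2) * m) :
    (1 / (k + 2 : ℝ)) ^ (k + 1) ≤ ‖((Nat.choose n (k + 1) : ℕ) : ℝ)⁻¹ •
      ∑ s ∈ (kSubsetsOf_finite (k + 1) (initialPart M n)).toFinset, frakXBasis k s‖ := by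
  classical
  set T := (kSubsetsOf_finite (k + 1) (initialPart M n)).toFinset with hT
  -- Consecutive blocks of `m` elements of `M`. The first `m` elements are skipped so that the least
  -- element of `F 0` is at least `m`.
  let F : Fin (k + 1) → Finset ℕ+ := fun i =>
    (Finset.Ioc ((i + 1) * m : ℕ) ((i + 2) * m)).attach.image
      fun l => M ⟨l.1, (Nat.zero_le _).trans_lt (Finset.mem_Ioc.1 l.2).1⟩
  have hF : ∀ i b, b ∈ F i ↔ ∃ l : ℕ+, ((i + 1) * m : ℕ) < l ∧ (l : ℕ) ≤ (i + 2) * m ∧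
      M l = b := by
    intro i b
    simp only [F, Finset.mem_image, Finset.mem_attach, true_and, Subtype.exists, Finset.mem_Ioc]
    constructor
    · rintro ⟨l, hl, rfl⟩
      exact ⟨⟨l, _⟩, hl.1, hl.2, rfl⟩
    · rintro ⟨l, h1, h2, rfl⟩
      exact ⟨l, ⟨h1, h2⟩, rfl⟩
  have hcard : ∀ i, (F i).card = m := by
    intro i
    rw [Finset.card_image_of_injective, Finset.card_attach, Nat.card_Ioc, ← Nat.sub_mul]
    · have : (i : ℕ) + 2 - (i + 1) = 1 := by omega
      rw [this, one_mul]
    · intro l l' h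
      exact Subtype.ext (congrArg PNat.val (M.injective h))
  have hlt : ∀ i i' : Fin (k + 1), i < i' → ∀ a ∈ F i, ∀ b ∈ F i', a < b := by
    intro i i' h a ha b hb
    obtain ⟨l, -, h1, rfl⟩ := (hF i a).1 ha
    obtain ⟨l', h2, -, rfl⟩ := (hF i' b).1 hb
    refine M.strictMono (PNat.coe_lt_coe _ _ |>.1 (lt_of_le_of_lt (h1.trans ?_) h2))
    have : (i : ℕ) < i' := h
    exact Nat.mul_le_mul_right _ (by omega)
  let P := T.filter fun s => ∀ i, s i ∈ F i
  have hP : IsSchreierPlegmatic P := by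
    refine ⟨F, hlt, fun i => by rw [hcard, hcard], fun s hs => (Finset.mem_filter.1 hs).2, ?_⟩
    intro a ha
    obtain ⟨l, h1, -, rfl⟩ := (hF 0 a).1 ha
    rw [hcard]
    have h2 : (l : ℕ) ≤ M l := PNat.coe_le_coe _ _ |>.2 M.strictMono.le_apply
    simp only [Fin.val_zero, zero_add, one_mul] at h1
    omega
  have hPcard : (m : ℕ) ^ (k + 1) ≤ P.card := by
    have h1 : (Fintype.piFinset F).card = (m : ℕ) ^ (k + 1) := by
      rw [Fintype.card_piFinset, Finset.prod_congr rfl fun i _ => hcard i, Finset.prod_const,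
        Finset.card_univ, Fintype.card_fin]
    rw [← h1]
    refine Finset.card_le_card_of_surjOn (fun s : KSub (k + 1) => (s : Fin (k + 1) → ℕ+)) ?_
    intro g hg
    have hg' := Fintype.mem_piFinset.1 hg
    refine ⟨OrderEmbedding.ofStrictMono g fun i i' h => hlt i i' h _ (hg' i) _ (hg' i'), ?_, rfl⟩
    refine Finset.mem_coe.2 (Finset.mem_filter.2 ⟨?_, hg'⟩)
    rw [hT, Set.Finite.mem_toFinset]
    intro i
    obtain ⟨l, -, h2, h3⟩ := (hF i _).1 (hg' i)
    change g i ∈ ((initialPart M n : Finset ℕ+) : Set ℕ+)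
    rw [← h3]
    refine Finset.mem_coe.2 (Finset.mem_map_of_mem _ (Finset.mem_Icc.2 ⟨one_le, ?_⟩))
    rw [← PNat.coe_le_coe, hn]
    exact h2.trans (Nat.mul_le_mul_right _ (by omega))
  have hcoe : ((Nat.choose n (k + 1) : ℕ) : ℝ)⁻¹ • ∑ s ∈ T, frakXBasis k s =
      ofPre (((Nat.choose n (k + 1) : ℕ) : ℝ)⁻¹ • ∑ s ∈ T, FrakXPre.unit k s) := by
    rw [map_smul, map_sum]; rfl
  rw [hcoe, norm_ofPre]
  refine le_trans ?_ (FrakXPre.partNorm_le_norm hP _)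
  have hpart : FrakXPre.partNorm P (∑ s ∈ T, FrakXPre.unit k s) = P.card := by
    unfold FrakXPre.partNorm
    rw [Finset.card_eq_sum_ones, Nat.cast_sum]
    refine Finset.sum_congr rfl fun s hs => ?_
    rw [FrakXPre.coeff_sum]
    simp only [FrakXPre.coeff_unit, Finset.sum_ite_eq', (Finset.mem_filter.1 hs).1, if_true,
      abs_one, Nat.cast_one]
  rw [FrakXPre.partNorm_smul, hpart, abs_of_nonneg (by positivity)]
  have hchoose : 0 < Nat.choose n (k + 1) := Nat.choose_pos (by
    rw [hn]; exact le_trans (by omega) (Nat.le_mul_of_pos_right (k + 2) m.pos))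
  have hle : (Nat.choose n (k + 1) : ℝ) ≤ ((k + 2) * m) ^ (k + 1) := by
    have := Nat.choose_le_pow n (k + 1)
    rw [hn] at this ⊢
    exact_mod_cast this
  have hPc : ((m : ℕ) : ℝ) ^ (k + 1) ≤ P.card := by exact_mod_cast hPcard
  rw [inv_mul_eq_div, le_div_iff₀ (by exact_mod_cast hchoose)]
  calc (1 / (k + 2 : ℝ)) ^ (k + 1) * (Nat.choose n (k + 1) : ℝ)
      ≤ (1 / (k + 2 : ℝ)) ^ (k + 1) * ((k + 2) * m) ^ (k + 1) :=
        mul_le_mul_of_nonneg_left hle (by positivity)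
    _ = (m : ℝ) ^ (k + 1) := by
        rw [← mul_pow]
        congr 1
        field_simp
    _ ≤ P.card := hPc

theorem le_choose_succ_add (n k : ℕ) : n ≤ n.choose (k + 1) + k := by
  induction n with
  | zero => exact Nat.zero_le _
  | succ n ih =>
    rw [Nat.choose_succ_succ']
    rcases le_or_gt k n with h | h
    · have := Nat.choose_pos h
      omega
    · omega

/-- Each coordinate of an average is at most the reciprocal of the binomial coefficient, so the
limit could only be zero; `le_norm_cesaro` forbids this along multiples of `k + 2`. -/
theorem not_isCesaroSummable (M : ℕ+ ↪o ℕ+) (x₀ : FrakX k) :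
    ¬ IsCesaroSummable (k + 1) (frakXBasis k) M x₀ := by
  classical
  intro h
  have hchoose : Tendsto (fun n : ℕ+ => ((Nat.choose n (k + 1) : ℕ) : ℝ)⁻¹) atTop (𝓝 0) := by
    refine tendsto_inv_atTop_zero.comp (tendsto_natCast_atTop_atTop.comp ?_)
    refine tendsto_atTop.2 fun b => ?_
    filter_upwards [tendsto_PNat_val_atTop_atTop.eventually_ge_atTop (b + k)] with n hn
    have := le_choose_succ_add n k
    have hn' : b + k ≤ (n : ℕ) := hn
    omega
  have hcoord : ∀ t, coord t x₀ = 0 := by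
    intro t
    refine tendsto_nhds_unique ((coord t).continuous.tendsto x₀ |>.comp h) ?_
    refine squeeze_zero_norm (fun n => ?_) hchoose
    simp only [Function.comp_apply, map_smul, map_sum, smul_eq_mul, norm_mul]
    rw [Real.norm_of_nonneg (by positivity)]
    refine mul_le_of_le_one_right (by positivity) ?_
    simp only [← ofPre_unit, coord_ofPre, FrakXPre.coeff_unit, Finset.sum_ite_eq']
    split_ifs <;> simp
  have hx₀ : x₀ = 0 := by
    refine (hasSum_coord x₀).unique ?_
    simp only [hcoord, zero_smul]
    exact hasSum_zero
  have hnorm := h.norm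
  rw [hx₀, norm_zero] at hnorm
  have hev := hnorm.eventually (gt_mem_nhds (show (0 : ℝ) < (1 / (k + 2 : ℝ)) ^ (k + 1) by
    positivity))
  obtain ⟨n₀, hn₀⟩ := eventually_atTop.1 hev
  have hn : n₀ ≤ Nat.succPNat (k + 1) * n₀ := by
    rw [← PNat.coe_le_coe, PNat.mul_coe]
    exact Nat.le_mul_of_pos_left _ (Nat.succ_pos _)
  exact absurd (hn₀ _ hn) (not_lt.2 (le_norm_cesaro M n₀ (PNat.mul_coe _ _)))

end FrakX

/-! ### Reflexivity -/

namespace FrakXPre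

variable {k : ℕ}

theorem ip_restrict_eq_zero_of_disjoint {x y : FrakXPre k}
    (h : ∀ s, x.coeff s ≠ 0 → y.coeff s = 0) (A : Set (KSub (k + 1))) :
    ip (restrict A x) (restrict A y) = 0 := by
  classical
  rw [ip_eq_sum _ _ (T := (restrict A x).finite_support.toFinset) fun s hs => by simpa using hs]
  refine Finset.sum_eq_zero fun s _ => ?_
  rw [coeff_restrict, coeff_restrict]
  by_cases hs : s ∈ A
  · rw [Set.indicator_of_mem hs, Set.indicator_of_mem hs]
    by_cases h0 : x.coeff s = 0
    · rw [h0, zero_mul]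
    · rw [h s h0, mul_zero]
  · rw [Set.indicator_of_notMem hs, zero_mul]

/-- A bounded sequence of disjointly supported vectors has averages of arbitrarily small norm. -/
theorem exists_norm_average_le (hk : 1 ≤ k) (x : ℕ+ → FrakXPre k) {C ε : ℝ} (hε : 0 < ε)
    (hx : ∀ n, ‖x n‖ ≤ C)
    (hd : ∀ i j, i < j → ∀ s, (x i).coeff s ≠ 0 → (x j).coeff s = 0) :
    ∃ (N : ℕ) (n : Fin N → ℕ+), 0 < N ∧ ‖∑ j, (1 / N : ℝ) • x (n j)‖ ≤ ε := by
  -- A sequence is a family indexed by 1-sets; this is where `1 ≤ k` enters.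
  obtain ⟨r, L, hL⟩ := exists_norm_sum_tail_le hk (fun s : KSub 1 => x (s 0)) (ε := ε / 3)
    (by positivity) fun s => hx _
  obtain ⟨K, hK⟩ := exists_nat_gt (max (((k : ℝ) + 1) * C ^ 2 / (ε / 3) ^ 2)
    ((r : ℝ) ^ (k + 1) * C ^ 2 / (ε / 3) ^ 2))
  obtain ⟨hK1, hK2⟩ := max_lt_iff.1 hK
  have hKpos : (0 : ℝ) < K := lt_of_le_of_lt (by positivity) hK1
  have hKpos' : 0 < K := by exact_mod_cast hKpos
  let n : Fin K → ℕ+ := fun j => ((stdPlegma 1 K j).trans ((RelEmbedding.refl _).trans L)) 0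
  have hn : StrictMono n := ((isPlegma_stdPlegma 1 K).trans _).1 0
  have ha : ∀ j : Fin K, |(1 / K : ℝ)| ≤ 1 / K := fun j => by rw [abs_of_nonneg (by positivity)]
  let S : Set (KSub (k + 1)) := {σ | r < σ 0}
  have htail : ‖∑ j, (1 / K : ℝ) • restrict S (x (n j))‖ ≤ _ :=
    hL (RelEmbedding.refl _) K (fun _ => 1 / K) ha
  have hhead : ‖∑ j, (1 / K : ℝ) • restrict Sᶜ (x (n j))‖ ≤ ε / 3 := by
    refine le_of_sq_le_sq ((norm_sq_sum_le_of_ip_near (r := r) (c := 0) (η := 0) (D := C ^ 2)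
      (fun j σ hσ => ?_) le_rfl ha (zero_mul _) ?_ ?_).trans ?_) (by positivity)
    · rw [coeff_restrict] at hσ
      exact PNat.coe_le_coe _ _ |>.2 (not_lt.1 (Set.mem_of_indicator_ne_zero hσ))
    · intro j
      have h := (norm_restrict_le Sᶜ _).trans (hx (n j))
      rw [sub_zero, zero_add]
      exact abs_ip_le h h
    · intro i j hij
      rw [sub_zero, ip_restrict_eq_zero_of_disjoint (hd _ _ (hn hij)), abs_zero]
    · rw [div_lt_iff₀ (by positivity)] at hK2
      rw [zero_add, ← mul_div_assoc, div_le_iff₀ hKpos]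
      linarith
  have hsqrt : √((k + 1) * C ^ 2 / K) ≤ ε / 3 := by
    rw [Real.sqrt_le_left (by positivity), div_le_iff₀ hKpos]
    rw [div_lt_iff₀ (by positivity)] at hK1
    linarith
  refine ⟨K, n, hKpos', ?_⟩
  have hsum : ∑ j, (1 / K : ℝ) • x (n j) = ∑ j, (1 / K : ℝ) • restrict S (x (n j)) +
      ∑ j, (1 / K : ℝ) • restrict Sᶜ (x (n j)) := by
    rw [← Finset.sum_add_distrib]
    exact Finset.sum_congr rfl fun j _ => by rw [← smul_add, restrict_add_compl]
  rw [hsum]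
  refine (norm_add_le _ _).trans ?_
  linarith

/-- The unit vectors are shrinking. -/
theorem exists_finset_functional_le (hk : 1 ≤ k) (f : StrongDual ℝ (FrakXPre k)) {ε : ℝ}
    (hε : 0 < ε) : ∃ A : Finset (KSub (k + 1)), ∀ x : FrakXPre k,
      (∀ s ∈ A, x.coeff s = 0) → |f x| ≤ ε * ‖x‖ := by
  classical
  by_contra! hcon
  -- Failure yields, off every finite set, a vector of norm at most 1 with `f ≥ ε`. Iteration makes
  -- the supports disjoint, and averaging keeps `f ≥ ε` while the norm becomes small.
  have h1 : ∀ A : Finset (KSub (k + 1)), ∃ x : FrakXPre k, (∀ s ∈ A, x.coeff s = 0) ∧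
      ‖x‖ ≤ 1 ∧ ε ≤ f x := by
    intro A
    obtain ⟨x, hx, hlt⟩ := hcon A
    have hx0 : 0 < ‖x‖ := by
      rw [norm_pos_iff]
      rintro rfl
      simp at hlt
    have hfx : f x ≠ 0 := by
      intro h
      rw [h, abs_zero] at hlt
      exact absurd hlt (not_lt.2 (by positivity))
    refine ⟨(SignType.sign (f x) * ‖x‖⁻¹ : ℝ) • x, fun s hs => ?_, ?_, ?_⟩
    · rw [coeff_smul, hx s hs, mul_zero]
    · rw [norm_smul, norm_mul, norm_inv, norm_norm, mul_assoc, inv_mul_cancel₀ hx0.ne', mul_one]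
      rcases lt_trichotomy (f x) 0 with h | h | h <;> simp [h]
    · rw [map_smul, smul_eq_mul, mul_right_comm, sign_mul_self, ← div_eq_mul_inv,
        le_div_iff₀ hx0]
      exact hlt.le
  choose y hy0 hy1 hyε using h1
  let A : ℕ → Finset (KSub (k + 1)) := fun n =>
    n.rec ∅ fun _ B => B ∪ (y B).finite_support.toFinset
  have hA : ∀ n, A (n + 1) = A n ∪ (y (A n)).finite_support.toFinset := fun _ => rfl
  have hAmono : Monotone A := monotone_nat_of_le_succ fun n => by
    rw [hA]; exact Finset.subset_union_left
  obtain ⟨δ, hδ, hδf⟩ : ∃ δ : ℝ, 0 < δ ∧ ‖f‖ * δ < ε := by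
    refine ⟨ε / (‖f‖ + 1), by positivity, ?_⟩
    rw [← mul_div_assoc, div_lt_iff₀ (by positivity)]
    linarith
  obtain ⟨N, n, hN, hle⟩ := exists_norm_average_le hk (fun i : ℕ+ => y (A i)) hδ
    (fun i => hy1 _) fun i j hij s hs => by
      refine hy0 _ s (hAmono (show (i : ℕ) + 1 ≤ j from hij) ?_)
      rw [hA]
      exact Finset.mem_union_right _ (by simpa using hs)
  have h2 : ε ≤ f (∑ j, (1 / N : ℝ) • y (A (n j))) := by
    simp only [map_sum, map_smul, smul_eq_mul]
    calc ε = ∑ _j : Fin N, (1 / N : ℝ) * ε := by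
          rw [Finset.sum_const, Finset.card_univ, Fintype.card_fin, nsmul_eq_mul]
          have : (N : ℝ) ≠ 0 := by positivity
          field_simp
      _ ≤ _ := Finset.sum_le_sum fun j _ => mul_le_mul_of_nonneg_left (hyε _) (by positivity)
  have h3 := (le_abs_self _).trans (f.le_opNorm (∑ j, (1 / N : ℝ) • y (A (n j))))
  have h4 := mul_le_mul_of_nonneg_left hle (norm_nonneg f)
  linarith

end FrakXPre

namespace FrakX

variable {k : ℕ}

/-- The difference is, up to sign, `f` on coordinates outside `A`, which is small because the basis
is shrinking. -/
theorem tendsto_comp_proj (hk : 1 ≤ k) (f : StrongDual ℝ (FrakX k)) :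
    Tendsto (fun A => f.comp (proj A)) atTop (𝓝 f) := by
  classical
  rw [Metric.tendsto_atTop]
  intro ε hε
  obtain ⟨A₀, hA₀⟩ := FrakXPre.exists_finset_functional_le hk (f.comp ofPre) (half_pos hε)
  refine ⟨A₀, fun A hA => ?_⟩
  rw [dist_eq_norm]
  refine lt_of_le_of_lt (ContinuousLinearMap.opNorm_le_bound _ (half_pos hε).le fun x => ?_)
    (half_lt_self hε)
  refine denseRange_ofPre.induction_on
    (p := fun x => ‖(f.comp (proj A) - f) x‖ ≤ ε / 2 * ‖x‖) x
    (isClosed_le (by fun_prop) (by fun_prop)) fun y => ?_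
  let z := FrakXPre.restrict ((A : Set (KSub (k + 1)))ᶜ) y
  have h1 : (f.comp (proj A) - f) (ofPre y) = -(f.comp ofPre) z := by
    have h2 := FrakXPre.restrict_add_compl (A : Set (KSub (k + 1))) y
    have h3 : f (ofPre y) = f (ofPre (FrakXPre.restrict (A : Set (KSub (k + 1))) y)) +
        f (ofPre z) := by
      rw [← map_add, ← map_add, h2]
    simp only [sub_apply, ContinuousLinearMap.comp_apply, proj_ofPre, h3]
    ring
  rw [h1, norm_neg, Real.norm_eq_abs, norm_ofPre]
  refine (hA₀ z fun s hs => ?_).trans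
    (mul_le_mul_of_nonneg_left (FrakXPre.norm_restrict_le _ _) (half_pos hε).le)
  rw [FrakXPre.coeff_restrict]
  exact Set.indicator_of_notMem (Set.notMem_compl_iff.2 (Finset.mem_coe.2 (hA hs))) _

/-- The unit vectors are boundedly complete. -/
theorem summable_of_norm_sum_le {c : KSub (k + 1) → ℝ} {B : ℝ}
    (hc : ∀ A : Finset (KSub (k + 1)), ‖∑ s ∈ A, c s • frakXBasis k s‖ ≤ B) :
    Summable fun s => c s • frakXBasis k s := by
  classical
  let y : Finset (KSub (k + 1)) → FrakXPre k := fun A => ∑ s ∈ A, c s • FrakXPre.unit k s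
  have hy : ∀ A, ofPre (y A) = ∑ s ∈ A, c s • frakXBasis k s := fun A => by
    rw [map_sum]
    exact Finset.sum_congr rfl fun s _ => map_smul _ _ _
  have hcoeff : ∀ A t, (y A).coeff t = if t ∈ A then c t else 0 := fun A t => by
    rw [FrakXPre.coeff_sum]
    simp only [FrakXPre.coeff_smul, FrakXPre.coeff_unit, mul_ite, mul_one, mul_zero,
      Finset.sum_ite_eq']
  have hrestrict : ∀ A A' : Finset (KSub (k + 1)), A ⊆ A' →
      FrakXPre.restrict (A : Set (KSub (k + 1))) (y A') = y A := by
    intro A A' h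
    refine FrakXPre.ext_coeff fun t => ?_
    rw [FrakXPre.coeff_restrict, Set.indicator_apply, hcoeff, hcoeff]
    by_cases ht : t ∈ A
    · simp [ht, h ht]
    · simp [ht]
  have hsq : ∀ A D, Disjoint A D → ‖y A‖ ^ 2 + ‖y D‖ ^ 2 ≤ ‖y (A ∪ D)‖ ^ 2 := by
    intro A D h
    rw [← hrestrict A (A ∪ D) Finset.subset_union_left,
      ← hrestrict D (A ∪ D) Finset.subset_union_right]
    exact FrakXPre.norm_sq_restrict_add_le (Finset.disjoint_coe.2 h) _
  have hbdd : BddAbove (Set.range fun A => ‖y A‖ ^ 2) := by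
    refine ⟨B ^ 2, ?_⟩
    rintro _ ⟨A, rfl⟩
    refine pow_le_pow_left₀ (norm_nonneg _) ?_ 2
    rw [← norm_ofPre, hy]
    exact hc A
  rw [summable_iff_vanishing_norm]
  intro ε hε
  -- Once `‖y A‖ ^ 2` is within `ε ^ 2` of the supremum, the lower 2-estimate leaves less than `ε`
  -- for any block disjoint from `A`.
  obtain ⟨A, hA⟩ := exists_lt_of_lt_ciSup (f := fun A => ‖y A‖ ^ 2)
    (sub_lt_self (⨆ A, ‖y A‖ ^ 2) (show 0 < ε ^ 2 by positivity))
  refine ⟨A, fun D hD => ?_⟩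
  rw [← hy, norm_ofPre]
  have h1 := hsq A D hD.symm
  have h2 := le_ciSup hbdd (A ∪ D)
  refine lt_of_pow_lt_pow_left₀ 2 hε.le ?_
  linarith

/-- The values `φ (coord s)` are coefficients of partial sums bounded by `‖φ‖`, so bounded
completeness gives a vector. It represents `φ` because `f.comp (proj A)` tends to `f` in norm. -/
theorem surjective_inclusionInDoubleDual (hk : 1 ≤ k) :
    Function.Surjective (NormedSpace.inclusionInDoubleDual ℝ (FrakX k)) := by
  intro φ
  have hcomp : ∀ (A : Finset (KSub (k + 1))) (f : StrongDual ℝ (FrakX k)),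
      φ (f.comp (proj A)) = f (∑ s ∈ A, φ (coord s) • frakXBasis k s) := by
    intro A f
    have h : f.comp (proj A) = ∑ s ∈ A, f (frakXBasis k s) • coord s := by
      ext x
      simp [proj_apply, mul_comm]
    rw [h]
    simp [mul_comm]
  have hsum : Summable fun s => φ (coord s) • frakXBasis k s := by
    refine summable_of_norm_sum_le (B := ‖φ‖) fun A => ?_
    refine NormedSpace.norm_le_dual_bound ℝ _ (norm_nonneg φ) fun f => ?_
    rw [← hcomp]
    refine (φ.le_opNorm _).trans (mul_le_mul_of_nonneg_left ?_ (norm_nonneg φ))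
    refine ContinuousLinearMap.opNorm_le_bound _ (norm_nonneg f) fun x => ?_
    exact (f.le_opNorm _).trans
      (mul_le_mul_of_nonneg_left (norm_proj_apply_le A x) (norm_nonneg f))
  refine ⟨∑' s, φ (coord s) • frakXBasis k s, ?_⟩
  ext f
  rw [NormedSpace.dual_def]
  refine tendsto_nhds_unique ((f.continuous.tendsto _).comp hsum.hasSum) ?_
  have h := (φ.continuous.tendsto f).comp (tendsto_comp_proj hk f)
  refine h.congr fun A => ?_
  exact hcomp A f

end FrakX

theorem mainTheorem6 (k : ℕ) (hk : 1 ≤ k) :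
    -- `(e_s)` is an unconditional basis of `𝔛_{k+1}`
    (∃ b : UnconditionalSchauderBasis (KSub (k + 1)) ℝ (FrakX k),
      ∀ s, b.basis s = frakXBasis k s) ∧
    -- it generates a `(k+1)`-spreading model isometric to the usual basis of `ℓ¹`
    (∃ (E : Type) (_ : AddCommGroup E) (_ : Module ℝ E) (p : Seminorm ℝ E)
      (e : Module.Basis ℕ ℝ E),
      GeneratesSpreadingModel (k + 1) (frakXBasis k) (RelEmbedding.refl _) p e ∧
      IsometricSeq p e ellOneNorm ellOneBasis) ∧
    -- `𝔛_{k+1}` is reflexive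
    Function.Surjective (NormedSpace.inclusionInDoubleDual ℝ (FrakX k)) ∧
    -- no `k`-spreading model of `𝔛_{k+1}` is equivalent to the usual basis of `ℓ¹`
    (∀ (E : Type*) [AddCommGroup E] [Module ℝ E] (p : Seminorm ℝ E) (e : Module.Basis ℕ ℝ E),
      IsSpreadingModelOf (FrakX k) k p e → ¬ EquivalentSeq p e ellOneNorm ellOneBasis) ∧
    -- no `(k+1)`-subsequence of `(e_s)` is `(k+1)`-Cesàro summable
    (∀ (M : ℕ+ ↪o ℕ+) (x₀ : FrakX k),
      ¬ IsCesaroSummable (k + 1) (frakXBasis k) M x₀) :=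
  ⟨FrakX.exists_unconditionalSchauderBasis k, FrakX.exists_spreadingModel_ellOne k,
    FrakX.surjective_inclusionInDoubleDual hk,
    fun _ _ _ p e h => FrakX.not_equivalentSeq_ellOne le_rfl p e h,
    FrakX.not_isCesaroSummable⟩
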